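/- Let $\mathcal F=\bigoplus_{n\ge 0} L^2_{\mathrm{sym}}(\mathbb R^n)$ be the bosonic Fock space of a one-dimensional field, written in the momentum representation, so that $\psi=(\psi_n)_{n\ge0}$ with $\psi_n$ a symmetric square-integrable function of $n$ momenta. Let $(a_k\psi)_n(q)=\sqrt{n+1}\,\psi_{n+1}(k,q)$ be the annihilation operators of the momentum modes, $a_k^\dagger$ the creation operators, and $a_x=(2\pi)^{-1/2}\int dk\,e^{ikx}a_k$ those of the position modes; thus $a_x$ acts by the same formula on the position amplitudes $\tilde\psi_n(x)=(2\pi)^{-n/2}\int_{\mathbb R^n} e^{ik\cdot x}\psi_n(k)\,dk$. For a real function $g$, the operators $\int dk\,g(k)\,a_k^\dagger a_k$ and $\int dx\,g(x)\,a_x^\dagger a_x$ are unbounded operators on $\mathcal F$ with their natural (maximal) domains. Let $c>0$ and let $\omega:\mathbb R\to\mathbb R$ be a differentiable dispersion relation. Put $$T=\frac1c\int dx\,x\,a_x^\dagger a_x,\qquad H_C=\int dk\,\omega(k)\,a_k^\dagger a_k,\qquad \Lambda=\frac1c\int dk\,\omega'(k)\,a_k^\dagger a_k,\qquad N=\int dk\,a_k^\dagger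 a_k .$$ Products and commutators of unbounded operators are taken on their natural domains; in particular $[A,B]=AB-BA$ has the domain $D(AB)\cap D(BA)$. 1. For every $\psi\in D(TH_C)\cap D(H_CT)$ one has $\psi\in D(\Lambda)$ and $[T,H_C]\psi=i\Lambda\psi$. If moreover $\omega$ is continuously differentiable, then $[T,H_C]$ is densely defined and closable, and its closure is exactly $i\Lambda$. 2. $[\Lambda,H_C]$ is densely defined and vanishes on its domain. Moreover $-iH_C$ is the infinitesimal generator of a strongly continuous one-parameter unitary group $e^{-iH_Ct}$, and $e^{iH_Ct}\,\Lambda\, e^{-iH_Ct}=\Lambda$ for all $t\in\mathbb R$, as an equality of unbounded operators, domains included; that is, $\Lambda$ is a constant of motion. 3. If $\omega(k)=ck$, then $\Lambda=N$, and the closure of $[T,H_C]$ is $iN$. Here $N$ is the number operator: $\psi\in D(N)$ and $N\psi=\eta$ if and only if $\eta\in\mathcal F$ and $\eta_n=n\psi_n$ for all $n$. -/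

import Mathlib

open MeasureTheory FourierTransform
open scoped ENNReal

noncomputable section

namespace BosonicClock

/-! ### Bosonic Fock space of a one-dimensional field -/

/-- Configurations of `n` particles on the line (of momenta, or of positions). -/
abbrev Conf (n : ℕ) : Type := EuclideanSpace ℝ (Fin n)

/-- Square-integrable `n`-particle wave functions. -/
abbrev WaveFn (n : ℕ) : Type := Lp ℂ 2 (volume : Measure (Conf n))

/-- Relabelling of the particles by a permutation. -/
def relabel {n : ℕ} (σ : Equiv.Perm (Fin n)) (p : Conf n) : Conf n :=
  WithLp.toLp 2 (fun i => p (σ i))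

theorem measurePreserving_relabel {n : ℕ} (σ : Equiv.Perm (Fin n)) :
    MeasurePreserving (relabel σ) volume volume := by
  have h := (LinearIsometryEquiv.piLpCongrLeft 2 ℝ ℝ σ.symm).measurePreserving
  have h' : relabel σ = ⇑(LinearIsometryEquiv.piLpCongrLeft 2 ℝ ℝ σ.symm) := by
    funext p
    ext i
    simp [relabel, LinearIsometryEquiv.piLpCongrLeft_apply]
  rw [h']
  exact h

/-- The `n`-particle sector: wave functions that are symmetric under all permutations. -/
def sector (n : ℕ) : Submodule ℂ (WaveFn n) where
  carrier := {f | ∀ σ : Equiv.Perm (Fin n), (fun p => f (relabel σ p)) =ᵐ[volume] f}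
  zero_mem' := by
    intro σ
    have h0 := Lp.coeFn_zero ℂ 2 (volume : Measure (Conf n))
    have h1 := (measurePreserving_relabel σ).quasiMeasurePreserving.ae h0
    filter_upwards [h0, h1] with p h h'
    simp only [h, h', Pi.zero_apply]
  add_mem' := by
    intro f g hf hg σ
    have h0 := Lp.coeFn_add f g
    have h1 := (measurePreserving_relabel σ).quasiMeasurePreserving.ae h0
    filter_upwards [h0, h1, hf σ, hg σ] with p h h' h2 h3
    simp only [h, h', Pi.add_apply, h2, h3]
  smul_mem' := by
    intro a f hf σ
    have h0 := Lp.coeFn_smul a f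
    have h1 := (measurePreserving_relabel σ).quasiMeasurePreserving.ae h0
    filter_upwards [h0, h1, hf σ] with p h h' h2
    simp only [h, h', Pi.smul_apply, h2]

/-- The bosonic Fock space over `L²(ℝ)`: the Hilbert sum of all symmetric sectors, in the momentum
representation, so that `ψ n` is the `n`-particle amplitude as a function of the momenta. -/
abbrev Fock : Type := lp (fun n : ℕ => sector n) 2

/-! ### Amplitudes and the field operators `a_k`, `a_x` -/

/-- A sequence of pointwise defined `n`-particle amplitudes. -/
abbrev Amp : Type := (n : ℕ) → Conf n → ℂ

/-- The configuration `(k, q₁, …, qₙ)`. -/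
def insertParticle {n : ℕ} (k : ℝ) (q : Conf n) : Conf (n + 1) :=
  WithLp.toLp 2 (Fin.cons k (fun i => q i))

/-- The configuration `p` without its `j`-th particle. -/
def removeParticle {n : ℕ} (j : Fin (n + 1)) (p : Conf (n + 1)) : Conf n :=
  WithLp.toLp 2 (fun i => p (j.succAbove i))

/-- The annihilation operator at the mode `k`:
`(a_k Ψ)_n (q) = √(n+1) Ψ_{n+1} (k, q₁, …, qₙ)`. -/
def annihilate (k : ℝ) (Ψ : Amp) : Amp := fun n q =>
  (Real.sqrt ((n : ℝ) + 1) : ℂ) * Ψ (n + 1) (insertParticle k q)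

/-- The integral `∫ dk a_k† Φ_k` of a family of amplitudes. The creation operator is
`(a_k† Φ)_{n+1} (p) = (n+1)^(-1/2) ∑ⱼ δ(k - pⱼ) Φ_n (p without pⱼ)`, and the integral over `k`
is carried out by means of the delta functions. -/
def createIntegral (Φ : ℝ → Amp) : Amp
  | 0, _ => 0
  | n + 1, p => ((Real.sqrt ((n : ℝ) + 1))⁻¹ : ℂ) * ∑ j, Φ (p j) n (removeParticle j p)

/-- `∫ dk g(k) a_k† a_k Ψ`. -/
def densityIntegral (g : ℝ → ℝ) (Ψ : Amp) : Amp :=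
  createIntegral (fun k n q => (g k : ℂ) * annihilate k Ψ n q)

/-- The amplitudes of a state as a function of the momenta. -/
def momentumAmp (ψ : Fock) : Amp := fun n k => (ψ n : WaveFn n) k

/-- The amplitudes of a state as a function of the positions:
`ψ̃_n (x) = (2π)^(-n/2) ∫ exp(i k·x) ψ_n (k) dk`, where `dk` is `n`-dimensional. (Mathlib's inverse
Fourier transform has the kernel `exp(2π i k·u)`, hence `u = x / 2π`.) In this representation
`annihilate x` is the field operator `a_x = (2π)^(-1/2) ∫ dk exp(i k x) a_k`. -/
def positionAmp (ψ : Fock) : Amp := fun n x =>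
  (((Real.sqrt (2 * Real.pi))⁻¹ ^ n : ℝ) : ℂ) *
    (𝓕⁻ (ψ n : WaveFn n) : WaveFn n) ((2 * Real.pi)⁻¹ • x)

/-! ### Integrals of field operators as unbounded operators -/

/-- The assignment of amplitudes to states is linear and injective, up to null sets. -/
structure IsRepresentation (R : Fock → Amp) : Prop where
  add : ∀ ψ φ n, R (ψ + φ) n =ᵐ[volume] fun p => R ψ n p + R φ n p
  smul : ∀ (a : ℂ) ψ n, R (a • ψ) n =ᵐ[volume] fun p => a * R ψ n p
  inj : ∀ ψ φ, (∀ n, R ψ n =ᵐ[volume] R φ n) → ψ = φ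

theorem isRepresentation_momentumAmp : IsRepresentation momentumAmp where
  add ψ φ n := Lp.coeFn_add (ψ n : WaveFn n) (φ n : WaveFn n)
  smul a ψ n := Lp.coeFn_smul a (ψ n : WaveFn n)
  inj ψ φ h := by
    refine lp.ext (funext fun n => Subtype.ext (Lp.ext (h n)))

theorem quasiMeasurePreserving_const_smul (n : ℕ) {r : ℝ} (hr : r ≠ 0) :
    Measure.QuasiMeasurePreserving (fun x : Conf n => r • x) volume volume := by
  refine ⟨measurable_const_smul r, ?_⟩
  rw [Measure.map_addHaar_smul _ hr]
  exact Measure.smul_absolutelyContinuous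

theorem isRepresentation_positionAmp : IsRepresentation positionAmp where
  add ψ φ n := by
    have hr : (2 * Real.pi)⁻¹ ≠ 0 := by positivity
    have h0 := Lp.coeFn_add (𝓕⁻ (ψ n : WaveFn n) : WaveFn n) (𝓕⁻ (φ n : WaveFn n))
    filter_upwards [(quasiMeasurePreserving_const_smul n hr).ae h0] with x hx
    have h1 : (𝓕⁻ ((ψ + φ : Fock) n : WaveFn n) : WaveFn n)
        = 𝓕⁻ (ψ n : WaveFn n) + 𝓕⁻ (φ n : WaveFn n) :=
      (Lp.fourierTransformₗᵢ (Conf n) ℂ).symm.map_add _ _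
    simp only [positionAmp, h1, hx, Pi.add_apply, mul_add]
  smul a ψ n := by
    have hr : (2 * Real.pi)⁻¹ ≠ 0 := by positivity
    have h0 := Lp.coeFn_smul a (𝓕⁻ (ψ n : WaveFn n) : WaveFn n)
    filter_upwards [(quasiMeasurePreserving_const_smul n hr).ae h0] with x hx
    have h1 : (𝓕⁻ ((a • ψ : Fock) n : WaveFn n) : WaveFn n) = a • 𝓕⁻ (ψ n : WaveFn n) :=
      (Lp.fourierTransformₗᵢ (Conf n) ℂ).symm.map_smul _ _
    simp only [positionAmp, h1, hx, Pi.smul_apply, smul_eq_mul]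
    ring
  inj ψ φ h := by
    refine lp.ext (funext fun n => Subtype.ext ?_)
    apply (Lp.fourierTransformₗᵢ (Conf n) ℂ).symm.injective
    apply Lp.ext
    have hr : 2 * Real.pi ≠ 0 := by positivity
    filter_upwards [(quasiMeasurePreserving_const_smul n hr).ae (h n)] with x hx
    have hc : (((Real.sqrt (2 * Real.pi))⁻¹ ^ n : ℝ) : ℂ) ≠ 0 := by
      exact_mod_cast (by positivity : (Real.sqrt (2 * Real.pi))⁻¹ ^ n ≠ 0)
    simp only [positionAmp, smul_smul, inv_mul_cancel₀ hr, one_smul] at hx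
    exact mul_left_cancel₀ hc hx

theorem quasiMeasurePreserving_insert_remove {n : ℕ} (j : Fin (n + 1)) :
    Measure.QuasiMeasurePreserving
      (fun p : Conf (n + 1) => insertParticle (p j) (removeParticle j p)) volume volume := by
  have h := (measurePreserving_relabel j.cycleRange.symm).quasiMeasurePreserving
  convert h using 1
  funext p
  ext i
  refine Fin.cases ?_ (fun i => ?_) i
  · simp [insertParticle, relabel]
  · simp [insertParticle, removeParticle, relabel]

/-- `∫ dk g(k) a_k† a_k` respects linear combinations that hold up to null sets. -/
theorem densityIntegral_ae_linear (g : ℝ → ℝ) {Ψ Ψ₁ Ψ₂ : Amp} {a b : ℂ}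
    (h : ∀ n, Ψ n =ᵐ[volume] fun p => a * Ψ₁ n p + b * Ψ₂ n p) (n : ℕ) :
    densityIntegral g Ψ n =ᵐ[volume]
      fun p => a * densityIntegral g Ψ₁ n p + b * densityIntegral g Ψ₂ n p := by
  cases n with
  | zero => exact Filter.Eventually.of_forall fun p => by simp [densityIntegral, createIntegral]
  | succ n =>
    have hj : ∀ᵐ p : Conf (n + 1), ∀ j : Fin (n + 1),
        Ψ (n + 1) (insertParticle (p j) (removeParticle j p))
          = a * Ψ₁ (n + 1) (insertParticle (p j) (removeParticle j p))
            + b * Ψ₂ (n + 1) (insertParticle (p j) (removeParticle j p)) :=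
      ae_all_iff.2 fun j => (quasiMeasurePreserving_insert_remove j).ae (h (n + 1))
    filter_upwards [hj] with p hp
    simp only [densityIntegral, createIntegral, annihilate, hp]
    simp only [Finset.mul_sum, ← Finset.sum_add_distrib]
    refine Finset.sum_congr rfl fun j _ => ?_
    ring

/-- The graph of `∫ dk g(k) a_k† a_k` for the field operators of the representation `R`, on its
natural domain: all states `ψ` for which the resulting amplitudes are those of a state `η`. -/
def densityGraph (R : Fock → Amp) (hR : IsRepresentation R) (g : ℝ → ℝ) :
    Submodule ℂ (Fock × Fock) where
  carrier := {x | ∀ n, R x.2 n =ᵐ[volume] densityIntegral g (R x.1) n}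
  zero_mem' := by
    intro n
    have h0 : ∀ m, R 0 m =ᵐ[volume] fun p => (0 : ℂ) * R 0 m p + 0 * R 0 m p := by
      intro m
      have := hR.smul 0 0 m
      rw [zero_smul] at this
      filter_upwards [this] with p hp
      simpa using hp
    filter_upwards [h0 n, densityIntegral_ae_linear g h0 n] with p h1 h2
    simp only [Prod.snd_zero, Prod.fst_zero]
    rw [h1, h2]
    ring
  add_mem' := by
    intro x y hx hy n
    have h0 : ∀ m, R (x.1 + y.1) m =ᵐ[volume] fun p => (1 : ℂ) * R x.1 m p + 1 * R y.1 m p := by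
      intro m
      filter_upwards [hR.add x.1 y.1 m] with p hp
      rw [hp]
      ring
    filter_upwards [hx n, hy n, hR.add x.2 y.2 n, densityIntegral_ae_linear g h0 n]
      with p h1 h2 h3 h4
    simp only [Prod.snd_add, Prod.fst_add]
    rw [h3, h4, h1, h2]
    ring
  smul_mem' := by
    intro a x hx n
    have h0 : ∀ m, R (a • x.1) m =ᵐ[volume] fun p => a * R x.1 m p + 0 * R x.1 m p := by
      intro m
      filter_upwards [hR.smul a x.1 m] with p hp
      rw [hp]
      ring
    filter_upwards [hx n, hR.smul a x.2 n, densityIntegral_ae_linear g h0 n] with p h1 h2 h3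
    simp only [Prod.smul_snd, Prod.smul_fst]
    rw [h2, h3, h1]
    ring

/-- `∫ dk g(k) a_k† a_k` as an unbounded operator on Fock space. -/
def densityOp (R : Fock → Amp) (hR : IsRepresentation R) (g : ℝ → ℝ) : Fock →ₗ.[ℂ] Fock :=
  (densityGraph R hR g).toLinearPMap

/-- The graph above is single-valued, so that it is the graph of the operator. -/
theorem mem_graph_densityOp {R : Fock → Amp} (hR : IsRepresentation R) (g : ℝ → ℝ) (ψ η : Fock) :
    (ψ, η) ∈ (densityOp R hR g).graph ↔
      ∀ n, R η n =ᵐ[volume] densityIntegral g (R ψ) n := by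
  rw [densityOp, Submodule.toLinearPMap_graph_eq]
  · exact Iff.rfl
  · rintro ⟨φ, χ⟩ hx rfl
    refine hR.inj _ _ fun n => ?_
    have h0 := (densityGraph R hR g).zero_mem n
    exact (hx n).trans h0.symm

/-- `∫ dk g(k) a_k† a_k` for the momentum modes. -/
def momentumOp (g : ℝ → ℝ) : Fock →ₗ.[ℂ] Fock :=
  densityOp momentumAmp isRepresentation_momentumAmp g

/-- `∫ dx g(x) a_x† a_x` for the position modes. -/
def positionOp (g : ℝ → ℝ) : Fock →ₗ.[ℂ] Fock :=
  densityOp positionAmp isRepresentation_positionAmp g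

/-- The free Hamiltonian `H_C = ∫ dk ω(k) a_k† a_k`. -/
def clockHamiltonian (ω : ℝ → ℝ) : Fock →ₗ.[ℂ] Fock := momentumOp ω

/-- The time operator `T = (1/c) ∫ dx x a_x† a_x`. -/
def timeOp (c : ℝ) : Fock →ₗ.[ℂ] Fock := (1 / c : ℂ) • positionOp (fun x => x)

/-- `Λ = (1/c) ∫ dk ω'(k) a_k† a_k`. -/
def lambdaOp (c : ℝ) (ω : ℝ → ℝ) : Fock →ₗ.[ℂ] Fock := (1 / c : ℂ) • momentumOp (deriv ω)

/-- The number operator `N = ∫ dk a_k† a_k`. -/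
def numberOp : Fock →ₗ.[ℂ] Fock := momentumOp (fun _ => 1)

/-! ### Products, commutators and unitary groups for unbounded operators -/

section Unbounded

variable {E : Type*} [NormedAddCommGroup E] [InnerProductSpace ℂ E]

/-- The product `A B` on its natural domain `{ψ ∈ D(B) | B ψ ∈ D(A)}`. -/
def opMul (A B : E →ₗ.[ℂ] E) : E →ₗ.[ℂ] E :=
  A.comp (B.domRestrict ((A.domain.comap B.toFun).map B.domain.subtype)) (by
    rintro ⟨x, hx⟩
    obtain ⟨⟨y, hy, hyx⟩, hxB⟩ := hx
    have h : B.domRestrict ((A.domain.comap B.toFun).map B.domain.subtype)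
        ⟨x, ⟨⟨y, hy, hyx⟩, hxB⟩⟩ = B y := LinearPMap.domRestrict_apply hyx.symm
    rw [h]
    exact hy)

/-- The commutator `A B - B A` on its natural domain `D(A B) ∩ D(B A)`. -/
def commutator (A B : E →ₗ.[ℂ] E) : E →ₗ.[ℂ] E := opMul A B - opMul B A

/-- An everywhere defined operator, as an unbounded operator. -/
def ofUnitary (U : E ≃ₗᵢ[ℂ] E) : E →ₗ.[ℂ] E := U.toLinearEquiv.toLinearMap.toPMap ⊤

/-- `V t = exp(-i H t)`: `V` is a strongly continuous one-parameter unitary group whose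
infinitesimal generator, domain included, is `-i H`. -/
structure IsEvolution (H : E →ₗ.[ℂ] E) (V : ℝ → E ≃ₗᵢ[ℂ] E) : Prop where
  add : ∀ s t ψ, V (s + t) ψ = V s (V t ψ)
  continuous : ∀ ψ, Continuous fun t => V t ψ
  generator : ∀ ψ η, (ψ, η) ∈ H.graph ↔ HasDerivAt (fun t => V t ψ) (-Complex.I • η) 0

end Unbounded

end BosonicClock

end

/-! In the sector of n particles everything reduces to two kinds of operators on symmetric functions
of n momenta. By symmetry, `∫ dk g(k) a_k† a_k` is multiplication by `∑ⱼ g(pⱼ)`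
(`densityIntegral_ae_eq`), so `H_C` is multiplication by `Ω = ∑ⱼ ω(pⱼ)` and `Λ` by `(1/c) ∑ⱼ
ω'(pⱼ)`. The inverse Fourier transform turns translation along the diagonal (1, …, 1) into
multiplication by a phase, so `T` is `(i/c) D`, where `D` is the `L²` derivative along the diagonal
on its maximal domain (`mem_graph_positionOp`).

The commutator is then the Leibniz rule: `[T, H_C] = (i/c) (DΩ) = iΛ`. On the natural domain the
derivatives exist only in `L²`, and it is not known beforehand that `Λψ` is square-integrable.
Difference quotients that converge almost everywhere along a common subsequence give the product
rule pointwise (`deriv_translate_total_mul`), and with it `ψ ∈ D(Λ)`.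

For the closure, `Λ` is symmetric, so `(x, iΛx) ↦ Λx + ix` is isometric on the graph of `iΛ`. The
commutator therefore has closure `iΛ` once `Λ + i` maps its domain onto a dense set
(`closure_eq_of_symmetric`). If `ω` is `C¹`, the domain contains all symmetric compactly supported
`C¹` amplitudes. The function `Λ + i` is continuous without zeros, so nothing but zero is orthogonal
to its products with these amplitudes (`ae_eq_zero_of_orthogonal_symmetric`).

`Λ` and `H_C` commute because both are multiplications. Since `ω'` may be discontinuous, the density
of the domain of their commutator is shown with truncations to sets where both multipliers are
bounded. The evolution is multiplication by `exp(-itΩ)`; its generator is found by dominated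
convergence, first in each `L²` and then over the particle number. For `ω(k) = ck` the multiplier of
`Λ` is the particle number. -/

namespace BosonicClock

open Filter Topology

/-! ### Differentiability of curves of square-integrable functions -/

section Curves

variable {α : Type*} [MeasurableSpace α] {μ : Measure α}

/-- Dominated convergence in `L²`. -/
theorem tendsto_Lp_two_of_dominated {ι : Type*} {l : Filter ι} [l.IsCountablyGenerated]
    {F : ι → Lp ℂ 2 μ} {G : Lp ℂ 2 μ} {f : ι → α → ℂ} {b : α → ℝ}
    (hF : ∀ i, F i =ᵐ[μ] f i) (hb : MemLp b 2 μ)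
    (hbound : ∀ᶠ i in l, ∀ᵐ p ∂μ, ‖f i p‖ ≤ b p)
    (hlim : ∀ᵐ p ∂μ, Tendsto (fun i => f i p) l (𝓝 (G p))) :
    Tendsto F l (𝓝 G) := by
  -- Along a sequence the almost everywhere identities `F i = f i` are countably many and hold off
  -- one null set; dropping the first `N` terms makes the bound hold at every index.
  refine tendsto_of_seq_tendsto fun x hx => ?_
  obtain ⟨N, hN⟩ := eventually_atTop.1 (hx.eventually hbound)
  rw [← tendsto_add_atTop_iff_nat N, Lp.tendsto_Lp_iff_tendsto_eLpNorm']
  have hx' : Tendsto (fun k => x (k + N)) atTop l := hx.comp (tendsto_add_atTop_nat N)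
  simp only [Function.comp_apply]
  simp_rw [eLpNorm_eq_lintegral_rpow_enorm_toReal two_ne_zero ENNReal.ofNat_ne_top]
  have key : Tendsto (fun k => ∫⁻ p, ‖(F (x (k + N)) - G : α → ℂ) p‖ₑ ^ (2 : ℝ≥0∞).toReal ∂μ) atTop
      (𝓝 (∫⁻ _, 0 ∂μ)) := by
    refine tendsto_lintegral_of_dominated_convergence'
      (fun p => ‖(b p + ‖G p‖ : ℝ)‖ₑ ^ (2 : ℝ≥0∞).toReal) ?_ ?_ ?_ ?_
    · intro k
      exact ((Lp.aestronglyMeasurable _).sub (Lp.aestronglyMeasurable _)).enorm.pow_const _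
    · intro k
      filter_upwards [hN (k + N) (Nat.le_add_left _ _), hF (x (k + N))] with p h1 h2
      gcongr
      rw [enorm_le_iff_norm_le, Pi.sub_apply, h2]
      calc ‖f (x (k + N)) p - G p‖ ≤ ‖f (x (k + N)) p‖ + ‖G p‖ := norm_sub_le _ _
        _ ≤ b p + ‖G p‖ := by gcongr
        _ ≤ _ := le_abs_self _
    · have h2 : MemLp (fun p => b p + ‖G p‖) 2 μ := hb.add (Lp.memLp G).norm
      exact (lintegral_rpow_enorm_lt_top_of_eLpNorm_lt_top two_ne_zero ENNReal.ofNat_ne_top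
        h2.eLpNorm_lt_top).ne
    · have hall : ∀ᵐ p ∂μ, ∀ k, F (x (k + N)) p = f (x (k + N)) p :=
        ae_all_iff.2 fun k => hF (x (k + N))
      filter_upwards [hall, hlim] with p h1 h2
      have h3 : Tendsto (fun k => f (x (k + N)) p - G p) atTop (𝓝 0) := by
        simpa using (h2.comp hx').sub_const (G p)
      have h4 := (h3.enorm).ennrpow_const (2 : ℝ≥0∞).toReal
      simpa [h1] using h4
  have := key.ennrpow_const (1 / (2 : ℝ≥0∞).toReal)
  simpa using this

/-- A pointwise differentiable curve with square-integrable Lipschitz constant is differentiable in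
`L²`. -/
theorem hasDerivAt_Lp_two {F : ℝ → Lp ℂ 2 μ} {G : Lp ℂ 2 μ} {f : ℝ → α → ℂ} {g : α → ℂ}
    {b : α → ℝ} (hF : ∀ t, F t =ᵐ[μ] f t) (hG : G =ᵐ[μ] g) (hb : MemLp b 2 μ)
    (hbound : ∀ᶠ t in 𝓝 0, ∀ᵐ p ∂μ, ‖f t p - f 0 p‖ ≤ |t| * b p)
    (hd : ∀ᵐ p ∂μ, HasDerivAt (fun t => f t p) (g p) 0) : HasDerivAt F G 0 := by
  rw [hasDerivAt_iff_tendsto_slope_zero]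
  refine tendsto_Lp_two_of_dominated (f := fun t p => t⁻¹ • (f t p - f 0 p)) (b := b) ?_ hb ?_ ?_
  · intro t
    filter_upwards [Lp.coeFn_smul t⁻¹ (F (0 + t) - F 0), Lp.coeFn_sub (F (0 + t)) (F 0),
      hF (0 + t), hF 0] with p h1 h2 h3 h4
    rw [h1, Pi.smul_apply, h2, Pi.sub_apply, h3, h4, zero_add]
  · filter_upwards [nhdsWithin_le_nhds hbound, self_mem_nhdsWithin] with t ht ht0
    filter_upwards [ht] with p hp
    have h0 : 0 < |t| := abs_pos.2 ht0
    rw [norm_smul, norm_inv, Real.norm_eq_abs, inv_mul_le_iff₀ h0]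
    exact hp
  · filter_upwards [hd, hG] with p hp h
    rw [h]
    simpa using hasDerivAt_iff_tendsto_slope_zero.1 hp

/-- The difference quotients of a curve that is differentiable in `L²` converge almost everywhere
along a subsequence of any sequence. -/
theorem exists_subseq_slope_tendsto_ae {F : ℝ → Lp ℂ 2 μ} {G : Lp ℂ 2 μ} {f : ℝ → α → ℂ}
    (hF : ∀ t, F t =ᵐ[μ] f t) (h : HasDerivAt F G 0) {u : ℕ → ℝ}
    (hu : Tendsto u atTop (𝓝[≠] 0)) :
    ∃ φ : ℕ → ℕ, Tendsto φ atTop atTop ∧ ∀ᵐ p ∂μ,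
      Tendsto (fun k => (u (φ k))⁻¹ • (f (u (φ k)) p - f 0 p)) atTop (𝓝 (G p)) := by
  rw [hasDerivAt_iff_tendsto_slope_zero] at h
  obtain ⟨φ, hφ, hlim⟩ := (tendstoInMeasure_of_tendsto_Lp (h.comp hu)).exists_seq_tendsto_ae'
  refine ⟨φ, hφ, ?_⟩
  have hall : ∀ᵐ p ∂μ, ∀ k : ℕ, ((u (φ k))⁻¹ • (F (0 + u (φ k)) - F 0) : Lp ℂ 2 μ) p
      = (u (φ k))⁻¹ • (f (u (φ k)) p - f 0 p) := by
    refine ae_all_iff.2 fun k => ?_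
    filter_upwards [Lp.coeFn_smul (u (φ k))⁻¹ (F (0 + u (φ k)) - F 0),
      Lp.coeFn_sub (F (0 + u (φ k))) (F 0), hF (0 + u (φ k)), hF 0] with p h1 h2 h3 h4
    rw [h1, Pi.smul_apply, h2, Pi.sub_apply, h3, h4, zero_add]
  filter_upwards [hlim, hall] with p h1 h2
  simpa only [Function.comp_apply, h2] using h1

theorem tendsto_inv_nat_punctured : Tendsto (fun k : ℕ => ((k : ℝ) + 1)⁻¹) atTop (𝓝[≠] 0) := by
  refine tendsto_nhdsWithin_iff.2 ⟨?_, Eventually.of_forall fun k => ?_⟩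
  · simpa using tendsto_one_div_add_atTop_nhds_zero_nat (𝕜 := ℝ)
  · exact inv_ne_zero (by positivity)

/-- The derivative in `L²` is the pointwise derivative, where both exist. -/
theorem ae_eq_of_hasDerivAt_Lp_two {F : ℝ → Lp ℂ 2 μ} {G : Lp ℂ 2 μ} {f : ℝ → α → ℂ} {g : α → ℂ}
    (hF : ∀ t, F t =ᵐ[μ] f t) (h : HasDerivAt F G 0)
    (hd : ∀ᵐ p ∂μ, HasDerivAt (fun t => f t p) (g p) 0) : G =ᵐ[μ] g := by
  obtain ⟨φ, hφ, hlim⟩ := exists_subseq_slope_tendsto_ae hF h tendsto_inv_nat_punctured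
  filter_upwards [hlim, hd] with p h1 h2
  refine tendsto_nhds_unique h1 ?_
  have h3 := (hasDerivAt_iff_tendsto_slope_zero.1 h2).comp (tendsto_inv_nat_punctured.comp hφ)
  simpa [Function.comp_def] using h3

/-! ### Multiplication by a phase -/

theorem norm_cexp_I_mul (x : ℝ) : ‖Complex.exp (Complex.I * x)‖ = 1 := by
  rw [mul_comm]
  exact Complex.norm_exp_ofReal_mul_I x

theorem memLp_phase_mul {θ : α → ℝ} (hθ : Measurable θ) (f : Lp ℂ 2 μ) :
    MemLp (fun p => Complex.exp (Complex.I * θ p) * f p) 2 μ := by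
  refine (Lp.memLp f).of_le ?_ (Eventually.of_forall fun p => ?_)
  · exact AEStronglyMeasurable.mul (by fun_prop) (Lp.aestronglyMeasurable f)
  · rw [norm_mul, norm_cexp_I_mul, one_mul]

/-- Multiplication by the phase `exp(i θ)` in `L²`. -/
noncomputable def phaseMul (θ : α → ℝ) (hθ : Measurable θ) : Lp ℂ 2 μ →ₗᵢ[ℂ] Lp ℂ 2 μ where
  toFun f := (memLp_phase_mul hθ f).toLp
  map_add' f g := by
    ext1
    filter_upwards [(memLp_phase_mul hθ (f + g)).coeFn_toLp, (memLp_phase_mul hθ f).coeFn_toLp,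
      (memLp_phase_mul hθ g).coeFn_toLp, Lp.coeFn_add f g,
      Lp.coeFn_add (memLp_phase_mul hθ f).toLp (memLp_phase_mul hθ g).toLp] with p h1 h2 h3 h4 h5
    rw [h1, h5, Pi.add_apply, h2, h3, h4, Pi.add_apply, mul_add]
  map_smul' a f := by
    ext1
    filter_upwards [(memLp_phase_mul hθ (a • f)).coeFn_toLp, (memLp_phase_mul hθ f).coeFn_toLp,
      Lp.coeFn_smul a f, Lp.coeFn_smul a (memLp_phase_mul hθ f).toLp] with p h1 h2 h3 h4
    rw [h1, RingHom.id_apply, h4, Pi.smul_apply, h2, h3, Pi.smul_apply, smul_eq_mul, smul_eq_mul]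
    ring
  norm_map' f := by
    change ‖(memLp_phase_mul hθ f).toLp‖ = ‖f‖
    rw [Lp.norm_toLp, Lp.norm_def]
    congr 1
    refine eLpNorm_congr_norm_ae (Eventually.of_forall fun p => ?_)
    rw [norm_mul, norm_cexp_I_mul, one_mul]

theorem coeFn_phaseMul {θ : α → ℝ} (hθ : Measurable θ) (f : Lp ℂ 2 μ) :
    phaseMul θ hθ f =ᵐ[μ] fun p => Complex.exp (Complex.I * θ p) * f p :=
  (memLp_phase_mul hθ f).coeFn_toLp

theorem hasDerivAt_phase (x : ℝ) (z : ℂ) :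
    HasDerivAt (fun t : ℝ => Complex.exp (Complex.I * ((t * x : ℝ) : ℂ)) * z)
      (Complex.I * (x * z)) 0 := by
  have h1 : HasDerivAt (fun t : ℝ => ((t * x : ℝ) : ℂ)) ((1 * x : ℝ) : ℂ) 0 :=
    ((hasDerivAt_id (0 : ℝ)).mul_const x).ofReal_comp
  have h2 := ((h1.const_mul Complex.I).cexp).mul_const z
  have h3 : Complex.I * (x * z)
      = Complex.exp (Complex.I * ((0 * x : ℝ) : ℂ)) * (Complex.I * ((1 * x : ℝ) : ℂ)) * z := by
    rw [zero_mul, one_mul, Complex.ofReal_zero, mul_zero, Complex.exp_zero, one_mul, mul_assoc]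
  rw [h3]
  exact h2

/-- From `|exp(iy) - 1| ≤ |y|`: the candidate derivative itself dominates the difference quotients.
-/
theorem norm_phase_sub_le (x t : ℝ) (z : ℂ) :
    ‖Complex.exp (Complex.I * ((t * x : ℝ) : ℂ)) * z
      - Complex.exp (Complex.I * ((0 * x : ℝ) : ℂ)) * z‖ ≤ |t| * ‖(x : ℂ) * z‖ := by
  have h := Real.norm_exp_I_mul_ofReal_sub_one_le (x := t * x)
  rw [Real.norm_eq_abs, abs_mul] at h
  calc _ = ‖Complex.exp (Complex.I * ((t * x : ℝ) : ℂ)) - 1‖ * ‖z‖ := by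
        rw [← norm_mul]
        congr 1
        simp
        ring
    _ ≤ |t| * |x| * ‖z‖ := by gcongr
    _ = _ := by rw [norm_mul, Complex.norm_real, Real.norm_eq_abs, mul_assoc]

/-- The generator of the group of multiplications by `exp(i t X)` is the multiplication by `i X`. -/
theorem hasDerivAt_phaseMul_iff {X : α → ℝ} (hX : Measurable X) (f g : Lp ℂ 2 μ) :
    HasDerivAt (fun t : ℝ => phaseMul (fun p => t * X p) (hX.const_mul t) f) (Complex.I • g) 0
      ↔ g =ᵐ[μ] fun p => X p * f p := by
  have hF : ∀ t : ℝ, phaseMul (fun p => t * X p) (hX.const_mul t) f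
      =ᵐ[μ] fun p => Complex.exp (Complex.I * ((t * X p : ℝ) : ℂ)) * f p :=
    fun t => coeFn_phaseMul _ f
  have hd : ∀ᵐ p ∂μ, HasDerivAt (fun t : ℝ => Complex.exp (Complex.I * ((t * X p : ℝ) : ℂ)) * f p)
      (Complex.I * (X p * f p)) 0 := Eventually.of_forall fun p => hasDerivAt_phase (X p) (f p)
  constructor
  -- Differentiability in `L²` alone identifies the derivative with `i X f`, so `X f` is
  -- square-integrable as a consequence: this is the maximal domain.
  · intro h
    filter_upwards [ae_eq_of_hasDerivAt_Lp_two hF h hd, Lp.coeFn_smul Complex.I g] with p h1 h2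
    rw [h1, Pi.smul_apply, smul_eq_mul] at h2
    exact (mul_left_cancel₀ Complex.I_ne_zero h2).symm
  · intro h
    refine hasDerivAt_Lp_two hF ?_ (Lp.memLp g).norm (Eventually.of_forall fun t => ?_) hd
    · filter_upwards [h, Lp.coeFn_smul Complex.I g] with p h1 h2
      rw [h2, Pi.smul_apply, h1, smul_eq_mul]
    · filter_upwards [h] with p h1
      rw [h1]
      exact norm_phase_sub_le (X p) t (f p)

theorem continuous_phaseMul {X : α → ℝ} (hX : Measurable X) (f : Lp ℂ 2 μ) :
    Continuous fun t : ℝ => phaseMul (fun p => t * X p) (hX.const_mul t) f := by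
  refine continuous_iff_continuousAt.2 fun s => ?_
  refine tendsto_Lp_two_of_dominated (fun t => coeFn_phaseMul _ f) (Lp.memLp f).norm
    (Eventually.of_forall fun t => Eventually.of_forall fun p => ?_) ?_
  · rw [norm_mul, norm_cexp_I_mul, one_mul]
  · filter_upwards [coeFn_phaseMul (hX.const_mul s) f] with p hp
    rw [hp]
    refine Continuous.tendsto ?_ s
    fun_prop

end Curves

/-! ### The Fourier transform of translations and relabellings -/

section Fourier

variable {E : Type*} [NormedAddCommGroup E] [InnerProductSpace ℝ E] [FiniteDimensional ℝ E]
  [MeasurableSpace E] [BorelSpace E]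

/-- Translation of square-integrable functions. -/
noncomputable def translate (a : E) :
    Lp ℂ 2 (volume : Measure E) →ₗᵢ[ℂ] Lp ℂ 2 (volume : Measure E) :=
  Lp.compMeasurePreservingₗᵢ ℂ (fun p => p + a) (measurePreserving_add_right volume a)

theorem coeFn_translate (a : E) (f : Lp ℂ 2 (volume : Measure E)) :
    translate a f =ᵐ[volume] fun p => f (p + a) :=
  Lp.coeFn_compMeasurePreserving f (measurePreserving_add_right volume a)

/-- Two continuous maps on `L²` agree if they agree on Schwartz functions. -/
theorem eq_of_eq_on_schwartz {Y : Type*} [TopologicalSpace Y] [T2Space Y]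
    {A B : Lp ℂ 2 (volume : Measure E) → Y} (hA : Continuous A) (hB : Continuous B)
    (h : ∀ f : SchwartzMap E ℂ, A (f.toLp 2) = B (f.toLp 2)) : A = B :=
  DenseRange.equalizer (SchwartzMap.denseRange_toLpCLM (E := E) (F := ℂ) (p := 2)
    ENNReal.ofNat_ne_top) hA hB (funext h)

/-- On Schwartz functions this is the substitution `v ↦ v + a` in the Fourier integral; both sides
are continuous on `L²`, where Schwartz functions are dense. -/
theorem fourierInv_translate (a : E) (f : Lp ℂ 2 (volume : Measure E)) :
    𝓕⁻ (translate a f)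
      = phaseMul (fun u => -(2 * Real.pi) * inner ℝ a u) (by fun_prop) (𝓕⁻ f) := by
  have hc : Continuous fun f : Lp ℂ 2 (volume : Measure E) => 𝓕⁻ f :=
    (Lp.fourierTransformₗᵢ E ℂ).symm.continuous
  refine congrFun (eq_of_eq_on_schwartz (hc.comp (translate a).continuous)
    ((phaseMul _ _).continuous.comp hc) fun f => ?_) f
  have h1 : translate a (f.toLp 2) = (f.compSubConstCLM ℂ (-a)).toLp 2 := by
    ext1
    filter_upwards [coeFn_translate a (f.toLp 2), (f.compSubConstCLM ℂ (-a)).coeFn_toLp 2 volume,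
      (measurePreserving_add_right volume a).quasiMeasurePreserving.ae (f.coeFn_toLp 2 volume)]
      with p h1 h2 h3
    rw [h1, h2, h3, SchwartzMap.compSubConstCLM_apply, sub_neg_eq_add]
  simp only [Function.comp_apply]
  rw [h1, SchwartzMap.toLp_fourierInv_eq, SchwartzMap.toLp_fourierInv_eq]
  ext1
  filter_upwards [(𝓕⁻ (f.compSubConstCLM ℂ (-a))).coeFn_toLp 2 volume,
    coeFn_phaseMul (θ := fun u => -(2 * Real.pi) * inner ℝ a u) (by fun_prop) ((𝓕⁻ f).toLp 2),
    (𝓕⁻ f).coeFn_toLp 2 volume] with u h2 h3 h4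
  rw [h2, h3, h4, SchwartzMap.fourierInv_coe, SchwartzMap.fourierInv_coe]
  rw [Real.fourierInv_eq', Real.fourierInv_eq']
  rw [← integral_const_mul]
  refine Eq.trans ?_ (integral_add_right_eq_self _ a)
  refine integral_congr_ae (Eventually.of_forall fun v => ?_)
  simp only [SchwartzMap.compSubConstCLM_apply, sub_neg_eq_add, smul_eq_mul]
  rw [← mul_assoc, ← Complex.exp_add, inner_add_left]
  congr 2
  push_cast
  ring

/-- Applied to permutations of the particles, this makes the position amplitudes symmetric as well.
-/
theorem fourierInv_comp_isometry (A : E ≃ₗᵢ[ℝ] E) (f : Lp ℂ 2 (volume : Measure E)) :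
    𝓕⁻ (Lp.compMeasurePreservingₗᵢ ℂ A A.measurePreserving f : Lp ℂ 2 (volume : Measure E))
      = Lp.compMeasurePreservingₗᵢ ℂ A A.measurePreserving
        (𝓕⁻ f : Lp ℂ 2 (volume : Measure E)) := by
  have hc : Continuous fun f : Lp ℂ 2 (volume : Measure E) => 𝓕⁻ f :=
    (Lp.fourierTransformₗᵢ E ℂ).symm.continuous
  refine congrFun (eq_of_eq_on_schwartz
    (hc.comp (Lp.compMeasurePreservingₗᵢ ℂ A A.measurePreserving).continuous)
    ((Lp.compMeasurePreservingₗᵢ ℂ A A.measurePreserving).continuous.comp hc) fun f => ?_) f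
  have hcomp : ∀ g : SchwartzMap E ℂ, Lp.compMeasurePreservingₗᵢ ℂ A A.measurePreserving (g.toLp 2)
      = (SchwartzMap.compCLMOfContinuousLinearEquiv ℂ A.toContinuousLinearEquiv g).toLp 2 :=
    fun g => rfl
  simp only [Function.comp_apply]
  rw [hcomp, SchwartzMap.toLp_fourierInv_eq, SchwartzMap.toLp_fourierInv_eq, hcomp]
  congr 1
  ext u
  rw [SchwartzMap.fourierInv_coe, SchwartzMap.compCLMOfContinuousLinearEquiv_apply,
    SchwartzMap.compCLMOfContinuousLinearEquiv_apply, SchwartzMap.fourierInv_coe]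
  exact Real.fourierInv_comp_linearIsometry A f u

end Fourier

/-! ### Graphs of unbounded operators -/

section Graphs

variable {E : Type*} [NormedAddCommGroup E] [InnerProductSpace ℂ E]

theorem mem_graph_smul {A : E →ₗ.[ℂ] E} {a : ℂ} (ha : a ≠ 0) (x y : E) :
    (x, y) ∈ (a • A).graph ↔ (x, a⁻¹ • y) ∈ A.graph := by
  rw [LinearPMap.smul_graph, Submodule.mem_map]
  constructor
  · rintro ⟨⟨u, v⟩, hu, huv⟩
    simp only [LinearMap.prodMap_apply, LinearMap.id_coe, id, LinearMap.smul_apply,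
      Prod.mk_inj] at huv
    rw [← huv.1, ← huv.2, inv_smul_smul₀ ha]
    exact hu
  · intro h
    exact ⟨_, h, by
      simp only [LinearMap.prodMap_apply, LinearMap.id_coe, id, LinearMap.smul_apply,
        smul_inv_smul₀ ha]⟩

/-- The product is composition of graphs as relations. With the analogous descriptions of scalar
multiples and differences, later arguments about natural domains need only membership in graphs. -/
theorem mem_graph_opMul (A B : E →ₗ.[ℂ] E) (x z : E) :
    (x, z) ∈ (opMul A B).graph ↔ ∃ y, (x, y) ∈ B.graph ∧ (y, z) ∈ A.graph := by
  constructor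
  · intro h
    obtain ⟨w, hw, hz⟩ := (LinearPMap.mem_graph_iff _).1 h
    obtain ⟨w, ⟨⟨v, hv, hvw⟩, hwB⟩⟩ := w
    have h2 : B.domRestrict ((A.domain.comap B.toFun).map B.domain.subtype)
        ⟨w, ⟨⟨v, hv, hvw⟩, hwB⟩⟩ = B v := LinearPMap.domRestrict_apply hvw.symm
    simp only at hw hz
    have hvx : (v : E) = x := hvw.trans hw
    refine ⟨B v, by rw [← hvx]; exact B.mem_graph v, ?_⟩
    have hA := A.mem_graph ⟨B v, hv⟩
    convert hA using 2
    rw [← hz]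
    change A ⟨B.domRestrict _ _, _⟩ = _
    congr 2
  · rintro ⟨y, h1, h2⟩
    obtain ⟨u, hu, hy⟩ := (LinearPMap.mem_graph_iff _).1 h1
    obtain ⟨v, hv, hz⟩ := (LinearPMap.mem_graph_iff _).1 h2
    simp only at hu hy hv hz
    have hmem : B u ∈ A.domain := by rw [hy, ← hv]; exact v.2
    refine (LinearPMap.mem_graph_iff _).2
      ⟨⟨u, ⟨⟨u, hmem, rfl⟩, u.2⟩⟩, hu, ?_⟩
    have h3 : B.domRestrict ((A.domain.comap B.toFun).map B.domain.subtype)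
        ⟨u, ⟨⟨u, hmem, rfl⟩, u.2⟩⟩ = B u := LinearPMap.domRestrict_apply rfl
    simp only
    rw [← hz]
    change A ⟨B.domRestrict _ _, _⟩ = _
    congr 1
    exact Subtype.ext (h3.trans (hy.trans hv.symm))

theorem mem_graph_sub (A B : E →ₗ.[ℂ] E) (x z : E) :
    (x, z) ∈ (A - B).graph ↔ ∃ y₁ y₂, (x, y₁) ∈ A.graph ∧ (x, y₂) ∈ B.graph ∧ z = y₁ - y₂ := by
  constructor
  · intro h
    obtain ⟨w, hw, hz⟩ := (LinearPMap.mem_graph_iff _).1 h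
    simp only at hw hz
    refine ⟨A ⟨w, w.2.1⟩, B ⟨w, w.2.2⟩, ?_, ?_, ?_⟩
    · rw [← hw]; exact A.mem_graph ⟨w, w.2.1⟩
    · rw [← hw]; exact B.mem_graph ⟨w, w.2.2⟩
    · rw [← hz]; exact LinearPMap.sub_apply A B w
  · rintro ⟨y₁, y₂, h1, h2, rfl⟩
    obtain ⟨u, hu, hy⟩ := (LinearPMap.mem_graph_iff _).1 h1
    obtain ⟨v, hv, hz⟩ := (LinearPMap.mem_graph_iff _).1 h2
    simp only at hu hy hv hz
    subst hu
    have hv' : v = ⟨u, by rw [← hv]; exact v.2⟩ := Subtype.ext hv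
    refine (LinearPMap.mem_graph_iff _).2 ⟨⟨u, u.2, by rw [← hv]; exact v.2⟩, rfl, ?_⟩
    rw [← hy, ← hz]
    exact congrArg (fun w => A u - B w) hv'.symm

theorem mem_graph_commutator (A B : E →ₗ.[ℂ] E) (x z : E) :
    (x, z) ∈ (commutator A B).graph ↔ ∃ u v y₁ y₂, (x, u) ∈ B.graph ∧ (u, y₁) ∈ A.graph ∧
      (x, v) ∈ A.graph ∧ (v, y₂) ∈ B.graph ∧ z = y₁ - y₂ := by
  simp only [commutator, mem_graph_sub, mem_graph_opMul]
  constructor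
  · rintro ⟨y₁, y₂, ⟨u, h1, h2⟩, ⟨v, h3, h4⟩, h5⟩
    exact ⟨u, v, y₁, y₂, h1, h2, h3, h4, h5⟩
  · rintro ⟨u, v, y₁, y₂, h1, h2, h3, h4, h5⟩
    exact ⟨y₁, y₂, ⟨u, h1, h2⟩, ⟨v, h3, h4⟩, h5⟩

theorem mem_graph_ofUnitary (U : E ≃ₗᵢ[ℂ] E) (x y : E) :
    (x, y) ∈ (ofUnitary U).graph ↔ y = U x := by
  rw [LinearPMap.mem_graph_iff]
  constructor
  · rintro ⟨w, hw, h⟩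
    simp only at hw h
    rw [← h, ← hw]
    rfl
  · rintro rfl
    exact ⟨⟨x, trivial⟩, rfl, rfl⟩

theorem le_of_graph {A B : E →ₗ.[ℂ] E} (h : ∀ x y, (x, y) ∈ A.graph → (x, y) ∈ B.graph) : A ≤ B :=
  LinearPMap.le_of_le_graph fun p hp => h p.1 p.2 hp

theorem eq_of_graph {A B : E →ₗ.[ℂ] E} (h : ∀ x y, (x, y) ∈ A.graph ↔ (x, y) ∈ B.graph) : A = B :=
  LinearPMap.eq_of_eq_graph (SetLike.ext fun p => h p.1 p.2)

/-- A subspace is dense if every vector orthogonal to it vanishes. -/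
theorem dense_of_forall_inner_eq_zero [CompleteSpace E] {K : Submodule ℂ E}
    (h : ∀ g : E, (∀ x ∈ K, inner ℂ x g = 0) → g = 0) : Dense (K : Set E) := by
  rw [Submodule.dense_iff_topologicalClosure_eq_top, Submodule.topologicalClosure_eq_top_iff,
    Submodule.eq_bot_iff]
  exact fun g hg => h g fun x hx => hg x hx

/-- For a closed operator `i Λ` with `Λ` symmetric, a restriction `A` of `i Λ` has the closure `i Λ`
as soon as the vectors `Λ x + i x`, with `x` in the domain of `A`, have no orthogonal complement. -/
theorem closure_eq_of_symmetric [CompleteSpace E] {A L : E →ₗ.[ℂ] E}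
    (hA : A ≤ Complex.I • L) (hclosed : (Complex.I • L).IsClosed)
    (hsymm : ∀ x y, (x, y) ∈ L.graph → (inner ℂ y x : ℂ).im = 0)
    (hrange : ∀ g : E, (∀ x y, (x, Complex.I • y) ∈ A.graph → inner ℂ (y + Complex.I • x) g = 0) →
      g = 0) :
    A.IsClosable ∧ A.closure = Complex.I • L := by
  have hcl : A.IsClosable := hclosed.isClosable.leIsClosable hA
  refine ⟨hcl, le_antisymm ?_ ?_⟩
  · have := hclosed.isClosable.closure_mono hA
    rwa [show (Complex.I • L).closure = Complex.I • L from LinearPMap.eq_of_eq_graph (by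
      rw [← hclosed.isClosable.graph_closure_eq_closure_graph,
        IsClosed.submodule_topologicalClosure_eq hclosed])] at this
  · have hI := Complex.I_ne_zero
    -- With `y = iΛx`, `S (x, y) = Λx + ix`.
    let S : E × E →ₗ[ℂ] E :=
      (-Complex.I) • LinearMap.snd ℂ E E + Complex.I • LinearMap.fst ℂ E E
    have hS : ∀ p, S p = (-Complex.I) • p.2 + Complex.I • p.1 := fun p => rfl
    have hK : Dense ((A.graph.map S : Submodule ℂ E) : Set E) := by
      refine dense_of_forall_inner_eq_zero fun g hg => hrange g fun x y hxy => ?_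
      have := hg _ (Submodule.mem_map_of_mem hxy)
      rw [hS] at this
      simpa [smul_smul] using this
    -- The cross term `Re ⟨Λx, ix⟩` vanishes because `⟨Λx, x⟩` is real. So `S` preserves the graph
    -- norm, and density of the image of the graph of `A` gives density of that graph in the graph
    -- of `iΛ`.
    have hnorm : ∀ x y, (x, y) ∈ (Complex.I • L).graph →
        ‖x‖ ≤ ‖S (x, y)‖ ∧ ‖y‖ ≤ ‖S (x, y)‖ := by
      intro x y hxy
      have h1 := hsymm _ _ ((mem_graph_smul hI x y).1 hxy)
      have h2 : ‖S (x, y)‖ ^ 2 = ‖y‖ ^ 2 + ‖x‖ ^ 2 := by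
        rw [hS, norm_add_sq (𝕜 := ℂ)]
        have h3 : RCLike.re (inner ℂ ((-Complex.I) • y) (Complex.I • x) : ℂ) = 0 := by
          rw [Complex.inv_I] at h1
          rw [inner_smul_right]
          simp only [RCLike.re_eq_complex_re, Complex.mul_re, Complex.I_re, Complex.I_im, h1]
          simp
        rw [h3]
        simp [norm_smul]
      constructor
      · refine le_of_sq_le_sq ?_ (norm_nonneg _)
        rw [h2]
        exact le_add_of_nonneg_left (sq_nonneg _)
      · refine le_of_sq_le_sq ?_ (norm_nonneg _)
        rw [h2]
        exact le_add_of_nonneg_right (sq_nonneg _)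
    refine le_of_graph fun x y hxy => ?_
    rw [← hcl.graph_closure_eq_closure_graph]
    change (x, y) ∈ closure (A.graph : Set (E × E))
    refine Metric.mem_closure_iff.2 fun ε hε => ?_
    obtain ⟨_, ⟨⟨u, v⟩, huv, rfl⟩, hd⟩ := Metric.mem_closure_iff.1 (hK (S (x, y))) ε hε
    refine ⟨(u, v), huv, ?_⟩
    have huv' := LinearPMap.le_graph_of_le hA huv
    have h3 := hnorm (x - u) (y - v) (by simpa using Submodule.sub_mem _ hxy huv')
    rw [dist_eq_norm, ← map_sub] at hd
    rw [Prod.dist_eq, dist_eq_norm, dist_eq_norm]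
    exact max_lt (h3.1.trans_lt hd) (h3.2.trans_lt hd)

end Graphs

/-! ### The field integrals in the sectors -/

/-- The sum `∑ⱼ g(pⱼ)` over the particles of a configuration. -/
def total (g : ℝ → ℝ) {n : ℕ} (p : Conf n) : ℝ := ∑ j, g (p j)

theorem total_relabel (g : ℝ → ℝ) {n : ℕ} (σ : Equiv.Perm (Fin n)) (p : Conf n) :
    total g (relabel σ p) = total g p :=
  Equiv.sum_comp σ fun j => g (p j)

theorem measurable_total {g : ℝ → ℝ} (hg : Measurable g) (n : ℕ) :
    Measurable (total g : Conf n → ℝ) :=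
  Finset.measurable_sum _ fun j _ => hg.comp (by fun_prop)

/-- Moving the `j`-th particle to the front is a cyclic permutation, which a symmetric amplitude
does not see. -/
theorem insertParticle_removeParticle {n : ℕ} (j : Fin (n + 1)) (p : Conf (n + 1)) :
    insertParticle (p j) (removeParticle j p) = relabel j.cycleRange.symm p := by
  ext i
  refine Fin.cases ?_ (fun i => ?_) i
  · simp [insertParticle, relabel]
  · simp [insertParticle, removeParticle, relabel]

/-- On symmetric amplitudes, `∫ dk g(k) a_k† a_k` is the multiplication by `∑ⱼ g(pⱼ)`. -/
theorem densityIntegral_ae_eq (g : ℝ → ℝ) {Ψ : Amp}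
    (hΨ : ∀ n (σ : Equiv.Perm (Fin n)), (fun p => Ψ n (relabel σ p)) =ᵐ[volume] Ψ n) (n : ℕ) :
    densityIntegral g Ψ n =ᵐ[volume] fun p => (total g p : ℂ) * Ψ n p := by
  cases n with
  | zero => exact Eventually.of_forall fun p => by simp [densityIntegral, createIntegral, total]
  | succ n =>
    have hj : ∀ᵐ p : Conf (n + 1), ∀ j : Fin (n + 1),
        Ψ (n + 1) (relabel j.cycleRange.symm p) = Ψ (n + 1) p :=
      ae_all_iff.2 fun j => hΨ (n + 1) j.cycleRange.symm
    filter_upwards [hj] with p hp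
    have hs : (Real.sqrt ((n : ℝ) + 1) : ℂ) ≠ 0 := by
      exact_mod_cast (Real.sqrt_pos.2 (by positivity)).ne'
    simp only [densityIntegral, createIntegral, annihilate, insertParticle_removeParticle, hp, total]
    rw [Complex.ofReal_sum, Finset.mul_sum, Finset.sum_mul]
    refine Finset.sum_congr rfl fun j _ => ?_
    field_simp

theorem momentumAmp_symmetric (ψ : Fock) (n : ℕ) (σ : Equiv.Perm (Fin n)) :
    (fun p => momentumAmp ψ n (relabel σ p)) =ᵐ[volume] momentumAmp ψ n :=
  (ψ n).2 σ

theorem mem_graph_momentumOp (g : ℝ → ℝ) (ψ η : Fock) :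
    (ψ, η) ∈ (momentumOp g).graph ↔
      ∀ n, (η n : WaveFn n) =ᵐ[volume] fun p => (total g p : ℂ) * (ψ n : WaveFn n) p := by
  rw [momentumOp, mem_graph_densityOp]
  refine forall_congr' fun n => ?_
  have h := densityIntegral_ae_eq g (momentumAmp_symmetric ψ) n
  exact ⟨fun h1 => h1.trans h, fun h1 => h1.trans h.symm⟩

/-- Relabelling of the particles as a linear isometry. -/
noncomputable def relabelIsometry {n : ℕ} (σ : Equiv.Perm (Fin n)) : Conf n ≃ₗᵢ[ℝ] Conf n :=
  LinearIsometryEquiv.piLpCongrLeft 2 ℝ ℝ σ.symm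

theorem coe_relabelIsometry {n : ℕ} (σ : Equiv.Perm (Fin n)) :
    ⇑(relabelIsometry σ) = relabel σ := by
  funext p
  ext i
  simp [relabel, relabelIsometry, LinearIsometryEquiv.piLpCongrLeft_apply]

theorem mem_sector_iff {n : ℕ} (f : WaveFn n) :
    f ∈ sector n ↔ ∀ σ : Equiv.Perm (Fin n), Lp.compMeasurePreservingₗᵢ ℂ (relabelIsometry σ)
      (relabelIsometry σ).measurePreserving f = f := by
  refine forall_congr' fun σ => ?_
  have h := Lp.coeFn_compMeasurePreserving f (relabelIsometry σ).measurePreserving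
  rw [Lp.ext_iff]
  have h' : (fun p => f (relabel σ p)) = f ∘ relabelIsometry σ := by
    rw [coe_relabelIsometry]
    rfl
  rw [h']
  exact ⟨fun h1 => h.trans h1, fun h1 => h.symm.trans h1⟩

theorem isClosed_sector (n : ℕ) : IsClosed (sector n : Set (WaveFn n)) := by
  have : (sector n : Set (WaveFn n)) = ⋂ σ : Equiv.Perm (Fin n),
      {f | Lp.compMeasurePreservingₗᵢ ℂ (relabelIsometry σ)
        (relabelIsometry σ).measurePreserving f = f} := by
    ext f
    rw [Set.mem_iInter]
    exact mem_sector_iff f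
  rw [this]
  exact isClosed_iInter fun σ => isClosed_eq (LinearIsometry.continuous _) continuous_id

instance completeSpace_sector (n : ℕ) : CompleteSpace (sector n) :=
  (isClosed_sector n).completeSpace_coe

theorem fourierInv_mem_sector {n : ℕ} {f : WaveFn n} (hf : f ∈ sector n) :
    (𝓕⁻ f : WaveFn n) ∈ sector n := by
  rw [mem_sector_iff] at hf ⊢
  intro σ
  rw [← fourierInv_comp_isometry, hf σ]

theorem positionAmp_symmetric (ψ : Fock) (n : ℕ) (σ : Equiv.Perm (Fin n)) :
    (fun p => positionAmp ψ n (relabel σ p)) =ᵐ[volume] positionAmp ψ n := by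
  have hr : (2 * Real.pi)⁻¹ ≠ 0 := by positivity
  filter_upwards [(quasiMeasurePreserving_const_smul n hr).ae
    (fourierInv_mem_sector (ψ n).2 σ)] with p hp
  simp only [positionAmp]
  rw [← hp]
  rfl

/-- The configuration in which all the momenta are `1`. -/
def diagonal (n : ℕ) : Conf n := WithLp.toLp 2 fun _ => 1

theorem inner_diagonal {n : ℕ} (u : Conf n) : inner ℝ (diagonal n) u = total (fun x => x) u := by
  simp [diagonal, total, PiLp.inner_apply]

theorem hasDerivAt_fourierInv_iff {n : ℕ} {F : ℝ → WaveFn n} {G : WaveFn n} :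
    HasDerivAt (fun t => (𝓕⁻ (F t) : WaveFn n)) (𝓕⁻ G) 0 ↔ HasDerivAt F G 0 := by
  let L := Lp.fourierTransformₗᵢ (Conf n) ℂ
  constructor
  · intro h
    have h1 := (L.toContinuousLinearEquiv.toContinuousLinearMap.restrictScalars
      ℝ).hasFDerivAt.comp_hasDerivAt (0 : ℝ) h
    have h2 : F = fun t => L (𝓕⁻ (F t)) := funext fun t => (L.apply_symm_apply (F t)).symm
    have h3 : G = L (𝓕⁻ G) := (L.apply_symm_apply G).symm
    rw [h2, h3]
    exact h1
  · intro h
    exact (L.symm.toContinuousLinearEquiv.toContinuousLinearMap.restrictScalars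
      ℝ).hasFDerivAt.comp_hasDerivAt (0 : ℝ) h

/-- `∫ dx x a_x† a_x` is `i` times the generator of the translations of all momenta. -/
theorem mem_graph_positionOp (ψ η : Fock) :
    (ψ, η) ∈ (positionOp fun x => x).graph ↔ ∀ n, HasDerivAt
      (fun t : ℝ => translate (t • diagonal n) (ψ n : WaveFn n))
      (-Complex.I • (η n : WaveFn n)) 0 := by
  rw [positionOp, mem_graph_densityOp]
  refine forall_congr' fun n => ?_
  have h := densityIntegral_ae_eq (fun x => x) (positionAmp_symmetric ψ) n
  -- `X u` is minus the sum of the positions at `x = 2πu`; the minus sign is matched by writing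
  -- `-iη` as `i(-η)`. The rest is the change of variables between `u` and `x`.
  let X : Conf n → ℝ := fun u => -(2 * Real.pi) * total (fun x => x) u
  have hX : Measurable X := (measurable_total measurable_id n).const_mul _
  have h1 : (fun t : ℝ => (𝓕⁻ (translate (t • diagonal n) (ψ n : WaveFn n)) : WaveFn n))
      = fun t : ℝ => phaseMul (fun u => t * X u) (hX.const_mul t) (𝓕⁻ (ψ n : WaveFn n)) := by
    funext t
    rw [fourierInv_translate]
    congr 2
    funext u
    rw [real_inner_smul_left, inner_diagonal]
    simp only [X]
    ring
  have h2 : (𝓕⁻ (-Complex.I • (η n : WaveFn n)) : WaveFn n)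
      = Complex.I • (-𝓕⁻ (η n : WaveFn n)) := by
    rw [smul_neg, ← neg_smul]
    exact (Lp.fourierTransformₗᵢ (Conf n) ℂ).symm.map_smul _ _
  rw [← hasDerivAt_fourierInv_iff, h1, h2, hasDerivAt_phaseMul_iff hX]
  have hr : (2 * Real.pi)⁻¹ ≠ 0 := by positivity
  have hr' : 2 * Real.pi ≠ 0 := by positivity
  have hrc : (2 * Real.pi : ℂ) ≠ 0 := by exact_mod_cast hr'
  have hc : (((Real.sqrt (2 * Real.pi))⁻¹ ^ n : ℝ) : ℂ) ≠ 0 := by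
    exact_mod_cast (by positivity : (Real.sqrt (2 * Real.pi))⁻¹ ^ n ≠ 0)
  have htot : ∀ (r : ℝ) (u : Conf n), total (fun x => x) (r • u) = r * total (fun x => x) u := by
    intro r u
    simp [total, Finset.mul_sum]
  have hneg := Lp.coeFn_neg (𝓕⁻ (η n : WaveFn n) : WaveFn n)
  constructor
  · intro h3
    filter_upwards [(quasiMeasurePreserving_const_smul n hr').ae (h3.trans h), hneg] with u hu hn
    rw [hn, Pi.neg_apply]
    simp only [positionAmp, smul_smul, inv_mul_cancel₀ hr', one_smul, htot] at hu
    rw [mul_left_comm] at hu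
    rw [mul_left_cancel₀ hc hu]
    simp only [X]
    push_cast
    ring
  · intro h3
    refine EventuallyEq.trans ?_ h.symm
    filter_upwards [(quasiMeasurePreserving_const_smul n hr).ae h3,
      (quasiMeasurePreserving_const_smul n hr).ae hneg] with x hx hn
    rw [hn, Pi.neg_apply, neg_eq_iff_eq_neg] at hx
    simp only [positionAmp]
    rw [hx]
    simp only [X, htot]
    push_cast
    field_simp

/-! ### Operators of multiplication -/

/-- The relation is pointwise and `L²` limits are almost everywhere limits along subsequences. The
second subsequence is extracted from the first, so that both coordinates converge together. -/
theorem isClosed_ae_eq_mul {α : Type*} [MeasurableSpace α] {μ : Measure α} (X : α → ℂ) :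
    IsClosed {q : Lp ℂ 2 μ × Lp ℂ 2 μ | q.2 =ᵐ[μ] fun p => X p * q.1 p} := by
  refine IsSeqClosed.isClosed fun q r hq hr => ?_
  have h1 : Tendsto (fun k => (q k).1) atTop (𝓝 r.1) := (continuous_fst.tendsto r).comp hr
  have h2 : Tendsto (fun k => (q k).2) atTop (𝓝 r.2) := (continuous_snd.tendsto r).comp hr
  obtain ⟨φ, hφ, hφ'⟩ := (tendstoInMeasure_of_tendsto_Lp h1).exists_seq_tendsto_ae'
  obtain ⟨χ, hχ, hχ'⟩ := (tendstoInMeasure_of_tendsto_Lp (h2.comp hφ)).exists_seq_tendsto_ae'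
  have hall : ∀ᵐ p ∂μ, ∀ k, (q k).2 p = X p * (q k).1 p := ae_all_iff.2 hq
  filter_upwards [hφ', hχ', hall] with p h3 h4 h5
  refine tendsto_nhds_unique h4 ?_
  simp only [Function.comp_apply, h5]
  exact ((h3.comp hχ).const_mul (X p))

/-- Evaluation of a state at a particle number. -/
theorem continuous_component (n : ℕ) : Continuous fun ψ : Fock => (ψ n : WaveFn n) :=
  continuous_subtype_val.comp (lp.evalCLM ℂ (fun n : ℕ => sector n) 2 n).continuous

theorem isClosed_smul_momentumOp {a : ℂ} (ha : a ≠ 0) (g : ℝ → ℝ) :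
    (a • momentumOp g).IsClosed := by
  have : ((a • momentumOp g).graph : Set (Fock × Fock)) = ⋂ n : ℕ,
      (fun q : Fock × Fock => ((q.1 n : WaveFn n), ((a⁻¹ • q.2 : Fock) n : WaveFn n))) ⁻¹'
        {q | q.2 =ᵐ[volume] fun p => (total g p : ℂ) * q.1 p} := by
    ext ⟨ψ, η⟩
    rw [Set.mem_iInter]
    exact (mem_graph_smul ha ψ η).trans (mem_graph_momentumOp g ψ _)
  change IsClosed ((a • momentumOp g).graph : Set (Fock × Fock))
  rw [this]
  refine isClosed_iInter fun n => (isClosed_ae_eq_mul _).preimage ?_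
  exact ((continuous_component n).comp continuous_fst).prodMk
    ((continuous_component n).comp (continuous_snd.const_smul a⁻¹))

/-- In each sector the inner product is the integral of the real function `total g p * ‖ψ_n p‖ ^ 2`,
and the inner product of Fock space is the sum over the sectors. -/
theorem inner_momentumOp_im (g : ℝ → ℝ) {ψ η : Fock} (h : (ψ, η) ∈ (momentumOp g).graph) :
    (inner ℂ η ψ : ℂ).im = 0 := by
  rw [mem_graph_momentumOp] at h
  have hn : ∀ n, (inner ℂ (η n) (ψ n) : ℂ).im = 0 := by
    intro n
    have h1 : (inner ℂ (η n) (ψ n) : ℂ)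
        = ∫ p, ((total g p * ‖(ψ n : WaveFn n) p‖ ^ 2 : ℝ) : ℂ) := by
      rw [Submodule.coe_inner, L2.inner_def]
      refine integral_congr_ae ?_
      filter_upwards [h n] with p hp
      rw [hp, RCLike.inner_apply, map_mul, Complex.conj_ofReal, mul_comm, mul_assoc,
        Complex.conj_mul']
      push_cast
      ring
    rw [h1, integral_complex_ofReal]
    exact Complex.ofReal_im _
  have h2 := Complex.hasSum_im (lp.hasSum_inner η ψ)
  simp only [hn] at h2
  exact h2.unique hasSum_zero

/-! ### The free evolution -/

section Phase

variable {α : Type*} [MeasurableSpace α] {μ : Measure α}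

theorem phaseMul_phaseMul {θ χ : α → ℝ} (hθ : Measurable θ) (hχ : Measurable χ) (f : Lp ℂ 2 μ) :
    phaseMul θ hθ (phaseMul χ hχ f) = phaseMul (θ + χ) (hθ.add hχ) f := by
  ext1
  filter_upwards [coeFn_phaseMul hθ (phaseMul χ hχ f), coeFn_phaseMul hχ f,
    coeFn_phaseMul (hθ.add hχ) f] with p h1 h2 h3
  rw [h1, h2, h3, ← mul_assoc, ← Complex.exp_add, ← mul_add, Pi.add_apply, Complex.ofReal_add]

theorem norm_phaseMul_sub_le {X : α → ℝ} (hX : Measurable X) {f g : Lp ℂ 2 μ}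
    (h : g =ᵐ[μ] fun p => X p * f p) (t : ℝ) :
    ‖phaseMul (fun p => t * X p) (hX.const_mul t) f
      - phaseMul (fun p => 0 * X p) (hX.const_mul 0) f‖ ≤ |t| * ‖g‖ := by
  refine Lp.norm_le_mul_norm_of_ae_le_mul ?_
  filter_upwards [h, coeFn_phaseMul (hX.const_mul t) f, coeFn_phaseMul (hX.const_mul 0) f,
    Lp.coeFn_sub (phaseMul (fun p => t * X p) (hX.const_mul t) f)
      (phaseMul (fun p => 0 * X p) (hX.const_mul 0) f)] with p h1 h2 h3 h4
  rw [h4, Pi.sub_apply, h2, h3, h1]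
  exact norm_phase_sub_le (X p) t (f p)

end Phase

/-- Complex scalars in the difference quotients let them pass through the complex-linear maps
`component n`. -/
theorem hasDerivAt_iff_tendsto_complex_slope {E : Type*} [NormedAddCommGroup E] [NormedSpace ℝ E]
    [NormedSpace ℂ E] [IsScalarTower ℝ ℂ E] {f : ℝ → E} {e : E} :
    HasDerivAt f e 0 ↔
      Tendsto (fun t : ℝ => ((t⁻¹ : ℝ) : ℂ) • (f t - f 0)) (𝓝[≠] 0) (𝓝 e) := by
  rw [hasDerivAt_iff_tendsto_slope_zero]
  have h : ∀ (t : ℝ) (x : E), ((t⁻¹ : ℝ) : ℂ) • x = t⁻¹ • x := fun t x => by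
    rw [← algebraMap_smul ℂ t⁻¹ x]
    rfl
  simp only [h, zero_add]

theorem isEvolution_of_slope {E : Type*} [NormedAddCommGroup E] [InnerProductSpace ℂ E]
    {H : E →ₗ.[ℂ] E} {V : ℝ → E ≃ₗᵢ[ℂ] E} (add : ∀ s t ψ, V (s + t) ψ = V s (V t ψ))
    (continuous : ∀ ψ, Continuous fun t => V t ψ)
    (generator : ∀ ψ η, (ψ, η) ∈ H.graph ↔
      Tendsto (fun t : ℝ => ((t⁻¹ : ℝ) : ℂ) • (V t ψ - V 0 ψ)) (𝓝[≠] 0) (𝓝 (-Complex.I • η))) :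
    IsEvolution H V :=
  ⟨add, continuous, fun ψ η => (generator ψ η).trans hasDerivAt_iff_tendsto_complex_slope.symm⟩

/-- Evaluation at a particle number. -/
noncomputable def component (n : ℕ) : Fock →L[ℂ] WaveFn n :=
  (sector n).subtypeL.comp (lp.evalCLM ℂ (fun n : ℕ => sector n) 2 n)

theorem component_apply (n : ℕ) (ψ : Fock) : component n ψ = (ψ n : WaveFn n) := rfl

theorem component_slope (n : ℕ) (t : ℂ) (ψ φ : Fock) :
    component n (t • (ψ - φ)) = t • (component n ψ - component n φ) := by
  rw [map_smul, map_sub]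

/-- Dominated convergence in Fock space. -/
theorem tendsto_fock_of_dominated {ι : Type*} {l : Filter ι} {F : ι → Fock} {G η : Fock}
    (hlim : ∀ n, Tendsto (fun i => component n (F i)) l (𝓝 (component n G)))
    (hF : ∀ᶠ i in l, ∀ n, ‖component n (F i)‖ ≤ ‖η n‖) (hG : ∀ n, ‖G n‖ ≤ ‖η n‖) :
    Tendsto F l (𝓝 G) := by
  have hp : 0 < (2 : ℝ≥0∞).toReal := by norm_num
  have key : Tendsto (fun i => ∑' n, ‖(F i - G) n‖ ^ (2 : ℝ≥0∞).toReal) l (𝓝 (∑' _ : ℕ, 0)) := by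
    refine tendsto_tsum_of_dominated_convergence
      -- Both `F i` and `G` are bounded by `η` in every sector, hence their difference by `2‖η n‖`.
      (bound := fun n => (2 : ℝ) ^ (2 : ℝ≥0∞).toReal * ‖η n‖ ^ (2 : ℝ≥0∞).toReal)
      (((lp.memℓp η).summable hp).mul_left _) ?_ ?_
    · intro n
      have h1 : Tendsto (fun i => ‖(F i n : WaveFn n) - G n‖) l (𝓝 0) :=
        tendsto_iff_norm_sub_tendsto_zero.1 (hlim n)
      have h2 := h1.rpow_const (p := (2 : ℝ≥0∞).toReal) (Or.inr hp.le)
      rw [Real.zero_rpow hp.ne'] at h2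
      exact h2
    · filter_upwards [hF] with i hi n
      rw [Real.norm_of_nonneg (by positivity), ← Real.mul_rpow (by norm_num) (norm_nonneg _)]
      refine Real.rpow_le_rpow (norm_nonneg _) ?_ hp.le
      calc ‖F i n - G n‖ ≤ ‖F i n‖ + ‖G n‖ := norm_sub_le _ _
        _ ≤ ‖η n‖ + ‖η n‖ := add_le_add (hi n) (hG n)
        _ = 2 * ‖η n‖ := by ring
  rw [tendsto_iff_norm_sub_tendsto_zero]
  have h3 := key.rpow_const (p := 1 / (2 : ℝ≥0∞).toReal) (Or.inr (by positivity))
  simp_rw [lp.norm_eq_tsum_rpow hp]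
  simpa using h3

/-- A family of isometries of the summands acts on the Hilbert sum. -/
noncomputable def lpMapIsometry {G : ℕ → Type*} [∀ n, NormedAddCommGroup (G n)]
    [∀ n, NormedSpace ℂ (G n)] (U : ∀ n, G n →ₗᵢ[ℂ] G n) : lp G 2 →ₗᵢ[ℂ] lp G 2 where
  toFun ψ := ⟨fun n => U n (ψ n), (lp.memℓp ψ).mono' fun n => ((U n).norm_map _).le⟩
  map_add' ψ φ := lp.ext <| funext fun n => map_add (U n) (ψ n) (φ n)
  map_smul' a ψ := lp.ext <| funext fun n => map_smul (U n) a (ψ n)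
  norm_map' ψ := by
    have hp : 0 < (2 : ℝ≥0∞).toReal := by norm_num
    rw [lp.norm_eq_tsum_rpow hp, lp.norm_eq_tsum_rpow hp]
    congr 2
    funext n
    congr 1
    exact (U n).norm_map (ψ n)

theorem phaseMul_mem_sector {n : ℕ} {θ : Conf n → ℝ} (hθ : Measurable θ)
    (hs : ∀ (σ : Equiv.Perm (Fin n)) p, θ (relabel σ p) = θ p) {f : WaveFn n} (hf : f ∈ sector n) :
    phaseMul θ hθ f ∈ sector n := by
  intro σ
  filter_upwards [(measurePreserving_relabel σ).quasiMeasurePreserving.ae (coeFn_phaseMul hθ f),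
    coeFn_phaseMul hθ f, hf σ] with p h1 h2 h3
  rw [h1, h2, hs, h3]

section Evolution

variable {g : ℝ → ℝ}

theorem measurable_neg_total (hg : Measurable g) (n : ℕ) :
    Measurable fun p : Conf n => -total g p := (measurable_total hg n).neg

/-- Multiplication by `exp(-i t ∑ⱼ g(pⱼ))` in a sector. -/
noncomputable def sectorPhase (hg : Measurable g) (t : ℝ) (n : ℕ) : sector n →ₗᵢ[ℂ] sector n where
  toLinearMap := (phaseMul (fun p : Conf n => t * -total g p)
    ((measurable_neg_total hg n).const_mul t)).toLinearMap.restrict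
      fun _ hf => phaseMul_mem_sector _ (fun σ p => by rw [total_relabel]) hf
  norm_map' f := (phaseMul (fun p : Conf n => t * -total g p)
    ((measurable_neg_total hg n).const_mul t)).norm_map (f : WaveFn n)

theorem coe_sectorPhase (hg : Measurable g) (t : ℝ) {n : ℕ} (f : sector n) :
    (sectorPhase hg t n f : WaveFn n) = phaseMul (fun p => t * -total g p)
      ((measurable_neg_total hg n).const_mul t) (f : WaveFn n) := rfl

theorem sectorPhase_add (hg : Measurable g) (s t : ℝ) {n : ℕ} (f : sector n) :
    sectorPhase hg (s + t) n f = sectorPhase hg s n (sectorPhase hg t n f) := by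
  refine Subtype.ext ?_
  rw [coe_sectorPhase, coe_sectorPhase, coe_sectorPhase, phaseMul_phaseMul]
  congr 2
  funext p
  rw [Pi.add_apply]
  ring

/-- Multiplication of the amplitudes by `exp(-i t ∑ⱼ g(pⱼ))`. -/
noncomputable def evolutionIsometry (hg : Measurable g) (t : ℝ) : Fock →ₗᵢ[ℂ] Fock :=
  lpMapIsometry (sectorPhase hg t)

theorem evolutionIsometry_apply (hg : Measurable g) (t : ℝ) (ψ : Fock) (n : ℕ) :
    evolutionIsometry hg t ψ n = sectorPhase hg t n (ψ n) := rfl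

theorem evolutionIsometry_add (hg : Measurable g) (s t : ℝ) (ψ : Fock) :
    evolutionIsometry hg (s + t) ψ = evolutionIsometry hg s (evolutionIsometry hg t ψ) := by
  refine lp.ext <| funext fun n => ?_
  rw [evolutionIsometry_apply, evolutionIsometry_apply, evolutionIsometry_apply, sectorPhase_add]

theorem evolutionIsometry_zero (hg : Measurable g) (ψ : Fock) : evolutionIsometry hg 0 ψ = ψ :=
  -- An injective idempotent is the identity.
  (evolutionIsometry hg 0).injective (by rw [← evolutionIsometry_add, add_zero])

/-- The unitary group generated by `-i ∫ dk g(k) a_k† a_k`. -/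
noncomputable def evolution (hg : Measurable g) (t : ℝ) : Fock ≃ₗᵢ[ℂ] Fock :=
  LinearIsometryEquiv.ofSurjective (evolutionIsometry hg t) fun ψ =>
    ⟨evolutionIsometry hg (-t) ψ, by
      rw [← evolutionIsometry_add, add_neg_cancel, evolutionIsometry_zero]⟩

theorem evolution_apply (hg : Measurable g) (t : ℝ) (ψ : Fock) :
    evolution hg t ψ = evolutionIsometry hg t ψ := rfl

theorem evolution_component (hg : Measurable g) (t : ℝ) (ψ : Fock) (n : ℕ) :
    evolution hg t ψ n = sectorPhase hg t n (ψ n) := rfl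

theorem evolution_neg_apply (hg : Measurable g) (t : ℝ) (ψ : Fock) :
    evolution hg (-t) (evolution hg t ψ) = ψ := by
  rw [evolution_apply, evolution_apply, ← evolutionIsometry_add, neg_add_cancel,
    evolutionIsometry_zero]

theorem continuous_evolution (hg : Measurable g) (ψ : Fock) :
    Continuous fun t => evolution hg t ψ := by
  refine continuous_iff_continuousAt.2 fun s => tendsto_fock_of_dominated (η := ψ) (fun n => ?_)
    (Eventually.of_forall fun t n => ?_) fun n => ?_
  · simp only [component_apply, evolution_component, coe_sectorPhase]
    exact (continuous_phaseMul (measurable_neg_total hg n) (ψ n : WaveFn n)).tendsto s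
  · exact ((sectorPhase hg t n).norm_map (ψ n)).le
  · rw [evolution_component, LinearIsometry.norm_map]

/-- The sector version of the generator property: `hasDerivAt_phaseMul_iff` for the multiplier
`-total g`, with `-iη` read as `i(-η)`. -/
theorem hasDerivAt_component_evolution_iff (hg : Measurable g) (ψ η : Fock) (n : ℕ) :
    ((η n : WaveFn n) =ᵐ[volume] fun p => (total g p : ℂ) * (ψ n : WaveFn n) p) ↔
      HasDerivAt (fun t => component n (evolution hg t ψ)) (component n (-Complex.I • η)) 0 := by
  have h1 := hasDerivAt_phaseMul_iff (measurable_neg_total hg n) (ψ n : WaveFn n)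
    (-(η n : WaveFn n))
  have h2 : component n (-Complex.I • η) = Complex.I • -(η n : WaveFn n) := by
    rw [smul_neg, ← neg_smul]
    rfl
  simp only [component_apply n (evolution hg _ ψ), evolution_component, coe_sectorPhase]
  rw [h2, h1]
  have hneg := Lp.coeFn_neg (η n : WaveFn n)
  constructor
  · intro h
    filter_upwards [h, hneg] with p h2 h3
    rw [h3, Pi.neg_apply, h2]
    push_cast
    ring
  · intro h
    filter_upwards [h, hneg] with p h2 h3
    rw [h3, Pi.neg_apply, Complex.ofReal_neg, neg_mul] at h2
    exact neg_injective h2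

theorem norm_slope_evolution_le (hg : Measurable g) {ψ η : Fock}
    (h : (ψ, η) ∈ (momentumOp g).graph) (t : ℝ) (n : ℕ) :
    ‖component n (evolution hg t ψ) - component n (evolution hg 0 ψ)‖ ≤ |t| * ‖η n‖ := by
  rw [mem_graph_momentumOp] at h
  have h2 : (-(η n : WaveFn n) : WaveFn n) =ᵐ[volume]
      fun p => ((-total g p : ℝ) : ℂ) * (ψ n : WaveFn n) p := by
    filter_upwards [h n, Lp.coeFn_neg (η n : WaveFn n)] with p h2 h3
    rw [h3, Pi.neg_apply, h2]
    push_cast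
    ring
  have h3 := norm_phaseMul_sub_le (measurable_neg_total hg n) h2 t
  rw [norm_neg] at h3
  exact h3

/-- In the sector `n` the difference quotient is at most `‖η n‖`, and these norms are
square-summable, so convergence in every sector gives convergence in Fock space. -/
theorem tendsto_slope_evolution (hg : Measurable g) {ψ η : Fock}
    (h : (ψ, η) ∈ (momentumOp g).graph) :
    Tendsto (fun t : ℝ => ((t⁻¹ : ℝ) : ℂ) • (evolution hg t ψ - evolution hg 0 ψ)) (𝓝[≠] 0)
      (𝓝 (-Complex.I • η)) := by
  refine tendsto_fock_of_dominated (η := η) (fun n => ?_) ?_ fun n => ?_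
  · simp only [component_slope]
    exact hasDerivAt_iff_tendsto_complex_slope.1
      ((hasDerivAt_component_evolution_iff hg ψ η n).1 ((mem_graph_momentumOp g ψ η).1 h n))
  · filter_upwards [self_mem_nhdsWithin] with t ht n
    rw [component_slope, norm_smul, Complex.norm_real, norm_inv, Real.norm_eq_abs,
      inv_mul_le_iff₀ (abs_pos.2 ht)]
    exact norm_slope_evolution_le hg h t n
  · rw [lp.coeFn_smul, Pi.smul_apply, norm_smul, norm_neg, Complex.norm_I, one_mul]

/-- Projection to a sector is continuous, and membership in the graph is a condition on each sector
separately once `η` is a state. -/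
theorem mem_graph_of_tendsto_slope_evolution (hg : Measurable g) {ψ η : Fock}
    (h : Tendsto (fun t : ℝ => ((t⁻¹ : ℝ) : ℂ) • (evolution hg t ψ - evolution hg 0 ψ)) (𝓝[≠] 0)
      (𝓝 (-Complex.I • η))) : (ψ, η) ∈ (momentumOp g).graph := by
  refine (mem_graph_momentumOp g ψ η).2 fun n => ?_
  refine (hasDerivAt_component_evolution_iff hg ψ η n).2
    (hasDerivAt_iff_tendsto_complex_slope.2 ?_)
  simp only [← component_slope]
  exact ((component n).continuous.tendsto _).comp h

theorem isEvolution_evolution (hg : Measurable g) :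
    IsEvolution (momentumOp g) (evolution hg) :=
  isEvolution_of_slope (evolutionIsometry_add hg) (continuous_evolution hg) fun _ _ =>
    ⟨tendsto_slope_evolution hg, mem_graph_of_tendsto_slope_evolution hg⟩

/-- The field integrals over the momentum modes are invariant under the free evolution. -/
theorem mem_graph_momentumOp_evolution (hg : Measurable g) (f : ℝ → ℝ) (t : ℝ) (ψ η : Fock) :
    (evolution hg t ψ, evolution hg t η) ∈ (momentumOp f).graph ↔
      (ψ, η) ∈ (momentumOp f).graph := by
  rw [mem_graph_momentumOp, mem_graph_momentumOp]
  refine forall_congr' fun n => ?_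
  have h1 := coeFn_phaseMul ((measurable_neg_total hg n).const_mul t) (ψ n : WaveFn n)
  have h2 := coeFn_phaseMul ((measurable_neg_total hg n).const_mul t) (η n : WaveFn n)
  simp only [evolution_component, coe_sectorPhase]
  constructor
  · intro h
    filter_upwards [h, h1, h2] with p h3 h4 h5
    rw [h4, h5, mul_left_comm] at h3
    exact mul_left_cancel₀ (Complex.exp_ne_zero _) h3
  · intro h
    filter_upwards [h, h1, h2] with p h3 h4 h5
    rw [h4, h5, h3, mul_left_comm]

/-- The evolution carries the graph onto itself, since the phase commutes with the multiplier.
Comparing graphs gives equality of the domains too. -/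
theorem evolution_conj_momentumOp (hg : Measurable g) {a : ℂ} (ha : a ≠ 0) (f : ℝ → ℝ) (t : ℝ) :
    opMul (ofUnitary (evolution hg (-t))) (opMul (a • momentumOp f) (ofUnitary (evolution hg t)))
      = a • momentumOp f := by
  refine eq_of_graph fun ψ η => ?_
  have hinv : ∀ φ, evolution hg t (evolution hg (-t) φ) = φ := by
    intro φ
    have := evolution_neg_apply hg (-t) φ
    rwa [neg_neg] at this
  have key : ∀ φ, (evolution hg t ψ, evolution hg t φ) ∈ (a • momentumOp f).graph ↔
      (ψ, φ) ∈ (a • momentumOp f).graph := by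
    intro φ
    rw [mem_graph_smul ha, mem_graph_smul ha, ← map_smul, mem_graph_momentumOp_evolution]
  simp only [mem_graph_opMul, mem_graph_ofUnitary]
  constructor
  · rintro ⟨χ, ⟨_, rfl, h⟩, rfl⟩
    rwa [← key, hinv]
  · intro h
    exact ⟨evolution hg t η, ⟨_, rfl, (key η).2 h⟩, (evolution_neg_apply hg t η).symm⟩

end Evolution

/-! ### The product rule for the generator of translations -/

theorem hasDerivAt_total {ω : ℝ → ℝ} (hω : Differentiable ℝ ω) {n : ℕ} (p : Conf n) :
    HasDerivAt (fun t : ℝ => total ω (p + t • diagonal n)) (total (deriv ω) p) 0 := by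
  refine HasDerivAt.fun_sum fun j _ => ?_
  have h1 : HasDerivAt (fun t : ℝ => p j + t) 1 0 := (hasDerivAt_id (0 : ℝ)).const_add (p j)
  have h2 : HasDerivAt ω (deriv ω (p j)) (p j + 0) := by
    rw [add_zero]
    exact (hω (p j)).hasDerivAt
  have h3 := h2.comp (0 : ℝ) h1
  rw [mul_one] at h3
  have h4 : (fun t : ℝ => ω ((p + t • diagonal n) j)) = ω ∘ fun t : ℝ => p j + t := by
    funext t
    simp [diagonal]
  rw [h4]
  exact h3

/-- If `f` and `Ω f`, with `Ω(p) = ∑ⱼ ω(pⱼ)`, are differentiable along the diagonal in `L²`, then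
the derivatives obey the product rule. -/
theorem deriv_translate_total_mul {ω : ℝ → ℝ} (hω : Differentiable ℝ ω) {n : ℕ}
    {f f' h h' : WaveFn n} (hh : h =ᵐ[volume] fun p => (total ω p : ℂ) * f p)
    (hf : HasDerivAt (fun t : ℝ => translate (t • diagonal n) f) f' 0)
    (hd : HasDerivAt (fun t : ℝ => translate (t • diagonal n) h) h' 0) :
    h' =ᵐ[volume] fun p => (total ω p : ℂ) * f' p + (total (deriv ω) p : ℂ) * f p := by
  have hF : ∀ t : ℝ, translate (t • diagonal n) f =ᵐ[volume] fun p => f (p + t • diagonal n) :=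
    fun t => coeFn_translate _ f
  have hH : ∀ t : ℝ, translate (t • diagonal n) h =ᵐ[volume]
      fun p => (total ω (p + t • diagonal n) : ℂ) * f (p + t • diagonal n) := fun t =>
    (coeFn_translate _ h).trans
      ((measurePreserving_add_right volume (t • diagonal n)).quasiMeasurePreserving.ae hh)
  -- The second extraction refines the first, so that the quotients of `Ω f` and of `f` converge at
  -- almost every point along the same steps.
  obtain ⟨φ, hφ, hφ'⟩ := exists_subseq_slope_tendsto_ae hH hd tendsto_inv_nat_punctured
  obtain ⟨χ, hχ, hχ'⟩ := exists_subseq_slope_tendsto_ae hF hf (tendsto_inv_nat_punctured.comp hφ)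
  have hs : Tendsto (fun k => ((φ (χ k) : ℝ) + 1)⁻¹) atTop (𝓝[≠] 0) :=
    tendsto_inv_nat_punctured.comp (hφ.comp hχ)
  filter_upwards [hφ', hχ'] with p h1 h2
  have h3 := h1.comp hχ
  have h4 := (hasDerivAt_iff_tendsto_slope_zero.1 (hasDerivAt_total hω p)).comp hs
  simp only [Function.comp_def, zero_add, zero_smul, add_zero] at h2 h3 h4
  have hs0 : ∀ k, ((φ (χ k) : ℝ) + 1)⁻¹ ≠ 0 := fun k => inv_ne_zero (by positivity)
  generalize hu : (fun k => ((φ (χ k) : ℝ) + 1)⁻¹) = s at *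
  have hsk : ∀ k, ((φ (χ k) : ℝ) + 1)⁻¹ = s k := fun k => congrFun hu k
  simp only [hsk] at h2 h3 h4 hs0
  have h4c : Tendsto (fun k => (((s k)⁻¹ • (total ω (p + s k • diagonal n) - total ω p) : ℝ) : ℂ))
      atTop (𝓝 (total (deriv ω) p : ℂ)) := (Complex.continuous_ofReal.tendsto _).comp h4
  -- `f` need not be continuous, but its difference quotients converge here, so the differences
  -- themselves tend to zero.
  have h5 : Tendsto (fun k => f (p + s k • diagonal n)) atTop (𝓝 (f p)) := by
    have h6 := ((tendsto_nhdsWithin_iff.1 hs).1.smul h2).add_const (f p)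
    rw [zero_smul, zero_add] at h6
    refine h6.congr fun k => ?_
    rw [smul_smul, mul_inv_cancel₀ (hs0 k), one_smul, sub_add_cancel]
  -- Discrete Leibniz rule: `Δ(Ωf) = Ω Δf + ΔΩ · f(p + s)`, divided by the step.
  refine tendsto_nhds_unique h3 (((h2.const_mul (total ω p : ℂ)).add (h4c.mul h5)).congr ?_)
  intro k
  simp only [Complex.real_smul, smul_eq_mul]
  push_cast
  ring

theorem component_smul (a : ℂ) (ψ : Fock) (n : ℕ) :
    ((a • ψ : Fock) n : WaveFn n) = a • (ψ n : WaveFn n) := rfl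

theorem component_sub (ψ φ : Fock) (n : ℕ) :
    ((ψ - φ : Fock) n : WaveFn n) = (ψ n : WaveFn n) - (φ n : WaveFn n) := rfl

theorem mem_graph_timeOp {c : ℝ} (hc : c ≠ 0) (ψ η : Fock) :
    (ψ, η) ∈ (timeOp c).graph ↔ ∀ n, HasDerivAt
      (fun t : ℝ => translate (t • diagonal n) (ψ n : WaveFn n))
      ((-Complex.I * c) • (η n : WaveFn n)) 0 := by
  have h1 : (1 / c : ℂ) ≠ 0 := one_div_ne_zero (Complex.ofReal_ne_zero.2 hc)
  rw [timeOp, mem_graph_smul h1, mem_graph_positionOp]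
  simp only [component_smul, smul_smul, one_div, inv_inv]

theorem mem_graph_lambdaOp {c : ℝ} (hc : c ≠ 0) (ω : ℝ → ℝ) (ψ η : Fock) :
    (ψ, η) ∈ (lambdaOp c ω).graph ↔ ∀ n, (η n : WaveFn n) =ᵐ[volume]
      fun p => ((1 / c : ℂ) * (total (deriv ω) p : ℂ)) * (ψ n : WaveFn n) p := by
  have hc' := Complex.ofReal_ne_zero.2 hc
  have h1 : (1 / c : ℂ) ≠ 0 := one_div_ne_zero hc'
  rw [lambdaOp, mem_graph_smul h1, mem_graph_momentumOp]
  refine forall_congr' fun n => ?_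
  rw [component_smul]
  have h2 := Lp.coeFn_smul (1 / c : ℂ)⁻¹ (η n : WaveFn n)
  constructor
  · intro h
    filter_upwards [h, h2] with p h3 h4
    rw [h4, Pi.smul_apply, smul_eq_mul] at h3
    rw [mul_assoc, ← h3, mul_inv_cancel_left₀ h1]
  · intro h
    filter_upwards [h, h2] with p h3 h4
    rw [h4, Pi.smul_apply, smul_eq_mul, h3, mul_assoc, inv_mul_cancel_left₀ h1]

/-- The domain conditions say that `ψ` and `Ωψ` are both differentiable along the diagonal in every
sector, which is what the product rule needs; with `T = (i/c) D` only `(i/c) (DΩ) ψ` survives. -/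
theorem commutator_timeOp_le {c : ℝ} (hc : c ≠ 0) {ω : ℝ → ℝ} (hω : Differentiable ℝ ω) :
    commutator (timeOp c) (clockHamiltonian ω) ≤ Complex.I • lambdaOp c ω := by
  refine le_of_graph fun ψ z h => ?_
  obtain ⟨u, v, y₁, y₂, h1, h2, h3, h4, rfl⟩ := (mem_graph_commutator _ _ _ _).1 h
  rw [mem_graph_smul Complex.I_ne_zero, mem_graph_lambdaOp hc]
  intro n
  have hc' := Complex.ofReal_ne_zero.2 hc
  have key := deriv_translate_total_mul hω ((mem_graph_momentumOp _ _ _).1 h1 n)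
    ((mem_graph_timeOp hc _ _).1 h3 n) ((mem_graph_timeOp hc _ _).1 h2 n)
  rw [component_smul, component_sub]
  filter_upwards [key, (mem_graph_momentumOp _ _ _).1 h4 n,
    Lp.coeFn_smul (-Complex.I * c) (y₁ n : WaveFn n),
    Lp.coeFn_smul (-Complex.I * c) (v n : WaveFn n),
    Lp.coeFn_smul Complex.I⁻¹ ((y₁ n : WaveFn n) - (y₂ n : WaveFn n)),
    Lp.coeFn_sub (y₁ n : WaveFn n) (y₂ n : WaveFn n)] with p k1 k2 k3 k4 k5 k6
  rw [k5, Pi.smul_apply, k6, Pi.sub_apply, k2]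
  rw [k3, k4, Pi.smul_apply, Pi.smul_apply] at k1
  simp only [smul_eq_mul] at k1 ⊢
  rw [Complex.inv_I]
  field_simp
  linear_combination k1

/-! ### States with a definite particle number -/

theorem toLp_mem_sector {n : ℕ} {f : Conf n → ℂ} (hf : MemLp f 2 volume)
    (hs : ∀ σ : Equiv.Perm (Fin n), (fun p => f (relabel σ p)) =ᵐ[volume] f) :
    hf.toLp ∈ sector n := by
  intro σ
  filter_upwards [(measurePreserving_relabel σ).quasiMeasurePreserving.ae hf.coeFn_toLp,
    hf.coeFn_toLp, hs σ] with p h1 h2 h3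
  rw [h1, h2, h3]

/-- The state with `n` particles and a given symmetric amplitude. -/
noncomputable def pureState {n : ℕ} (f : Conf n → ℂ) (hf : MemLp f 2 volume)
    (hs : ∀ σ : Equiv.Perm (Fin n), (fun p => f (relabel σ p)) =ᵐ[volume] f) : Fock :=
  lp.single 2 n ⟨hf.toLp, toLp_mem_sector hf hs⟩

section PureState

variable {n : ℕ} {f : Conf n → ℂ} (hf : MemLp f 2 volume)
  (hs : ∀ σ : Equiv.Perm (Fin n), (fun p => f (relabel σ p)) =ᵐ[volume] f)

theorem pureState_self : (pureState f hf hs n : WaveFn n) = hf.toLp :=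
  congrArg Subtype.val (lp.single_apply_self (E := fun n => sector n) 2 n
    ⟨hf.toLp, toLp_mem_sector hf hs⟩)

theorem pureState_ne {m : ℕ} (hm : m ≠ n) : (pureState f hf hs m : WaveFn m) = 0 :=
  congrArg Subtype.val (lp.single_apply_ne (E := fun n => sector n) 2 n
    ⟨hf.toLp, toLp_mem_sector hf hs⟩ hm)

theorem inner_pureState (g : Fock) :
    (inner ℂ (pureState f hf hs) g : ℂ)
      = ∫ p, (g n : WaveFn n) p * (starRingEnd ℂ) (f p) := by
  rw [pureState, lp.inner_single_left, Submodule.coe_inner, L2.inner_def]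
  refine integral_congr_ae ?_
  filter_upwards [hf.coeFn_toLp] with p hp
  rw [RCLike.inner_apply, hp]

variable {h : Conf n → ℂ} (hh : MemLp h 2 volume)
  (ht : ∀ σ : Equiv.Perm (Fin n), (fun p => h (relabel σ p)) =ᵐ[volume] h)

theorem mem_graph_momentumOp_pureState {g : ℝ → ℝ}
    (hfh : h =ᵐ[volume] fun p => (total g p : ℂ) * f p) :
    (pureState f hf hs, pureState h hh ht) ∈ (momentumOp g).graph := by
  refine (mem_graph_momentumOp g _ _).2 fun m => ?_
  by_cases hm : m = n
  · subst hm
    rw [pureState_self, pureState_self]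
    filter_upwards [hf.coeFn_toLp, hh.coeFn_toLp, hfh] with p h1 h2 h3
    rw [h1, h2, h3]
  · rw [pureState_ne _ _ hm, pureState_ne _ _ hm]
    filter_upwards [Lp.coeFn_zero ℂ 2 (volume : Measure (Conf m))] with p h1
    rw [h1, Pi.zero_apply, mul_zero]

theorem mem_graph_lambdaOp_pureState {c : ℝ} (hc : c ≠ 0) {ω : ℝ → ℝ}
    (hfh : h =ᵐ[volume] fun p => ((1 / c : ℂ) * (total (deriv ω) p : ℂ)) * f p) :
    (pureState f hf hs, pureState h hh ht) ∈ (lambdaOp c ω).graph := by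
  refine (mem_graph_lambdaOp hc ω _ _).2 fun m => ?_
  by_cases hm : m = n
  · subst hm
    rw [pureState_self, pureState_self]
    filter_upwards [hf.coeFn_toLp, hh.coeFn_toLp, hfh] with p h1 h2 h3
    rw [h1, h2, h3]
  · rw [pureState_ne _ _ hm, pureState_ne _ _ hm]
    filter_upwards [Lp.coeFn_zero ℂ 2 (volume : Measure (Conf m))] with p h1
    rw [h1, Pi.zero_apply, mul_zero]

theorem mem_graph_timeOp_pureState {c : ℝ} (hc : c ≠ 0)
    (hfh : HasDerivAt (fun t : ℝ => translate (t • diagonal n) hf.toLp)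
      ((-Complex.I * c) • hh.toLp) 0) :
    (pureState f hf hs, pureState h hh ht) ∈ (timeOp c).graph := by
  refine (mem_graph_timeOp hc _ _).2 fun m => ?_
  by_cases hm : m = n
  · subst hm
    rw [pureState_self, pureState_self]
    exact hfh
  · rw [pureState_ne _ _ hm, pureState_ne _ _ hm]
    simp only [map_zero, smul_zero]
    exact hasDerivAt_const _ _

end PureState

/-! ### Continuously differentiable amplitudes with compact support -/

theorem relabel_ae_eq {n : ℕ} {f : Conf n → ℂ}
    (hs : ∀ (σ : Equiv.Perm (Fin n)) p, f (relabel σ p) = f p) (σ : Equiv.Perm (Fin n)) :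
    (fun p => f (relabel σ p)) =ᵐ[volume] f := Eventually.of_forall (hs σ)

/-- Compactly supported `C¹` functions are differentiable along any direction in `L²`. -/
theorem hasDerivAt_translate {E : Type*} [NormedAddCommGroup E] [InnerProductSpace ℝ E]
    [FiniteDimensional ℝ E] [MeasurableSpace E] [BorelSpace E] {f : E → ℂ}
    (hf : ContDiff ℝ 1 f) (hfc : HasCompactSupport f) (v : E) {F G : Lp ℂ 2 (volume : Measure E)}
    (hF : F =ᵐ[volume] f) (hG : G =ᵐ[volume] fun p => lineDeriv ℝ f p v) :
    HasDerivAt (fun t : ℝ => translate (t • v) F) G 0 := by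
  obtain ⟨C, hC⟩ := hf.lipschitzWith_of_hasCompactSupport hfc one_ne_zero
  have hK : IsCompact (Metric.cthickening ‖v‖ (tsupport f)) := IsCompact.cthickening hfc
  refine hasDerivAt_Lp_two (f := fun t p => f (p + t • v))
    -- For `|t| ≤ 1` the translates are supported in the `‖v‖`-thickening of the support, which is
    -- compact, and `C` is a Lipschitz constant of `f`.
    (b := (Metric.cthickening ‖v‖ (tsupport f)).indicator fun _ => C * ‖v‖) (fun t => ?_) hG
    (memLp_indicator_const 2 hK.measurableSet _ (Or.inr hK.measure_lt_top.ne)) ?_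
    (Eventually.of_forall fun p => ?_)
  · exact (coeFn_translate _ F).trans
      ((measurePreserving_add_right volume (t • v)).quasiMeasurePreserving.ae hF)
  · filter_upwards [Metric.closedBall_mem_nhds (0 : ℝ) one_pos] with t ht
    have ht1 : |t| ≤ 1 := by simpa using ht
    refine Eventually.of_forall fun p => ?_
    rw [zero_smul, add_zero]
    by_cases hp : p ∈ Metric.cthickening ‖v‖ (tsupport f)
    · rw [Set.indicator_of_mem hp]
      have := hC.dist_le_mul (p + t • v) p
      rw [dist_eq_norm, dist_eq_norm, add_sub_cancel_left, norm_smul, Real.norm_eq_abs] at this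
      linarith
    · have h1 : f p = 0 := by
        by_contra h0
        exact hp (Metric.self_subset_cthickening _ (subset_tsupport f h0))
      have h2 : f (p + t • v) = 0 := by
        by_contra h0
        refine hp (Metric.mem_cthickening_of_dist_le p (p + t • v) _ _ (subset_tsupport f h0) ?_)
        rw [dist_eq_norm, sub_add_cancel_left, norm_neg, norm_smul, Real.norm_eq_abs]
        exact mul_le_of_le_one_left (norm_nonneg v) ht1
      rw [h1, h2, Set.indicator_of_notMem hp]
      simp
  · exact ((hf.differentiable one_ne_zero).differentiableAt.lineDifferentiableAt).hasLineDerivAt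

section Core

variable {n : ℕ} {f : Conf n → ℂ}

theorem lineDeriv_relabel (hs : ∀ (σ : Equiv.Perm (Fin n)) p, f (relabel σ p) = f p)
    (σ : Equiv.Perm (Fin n)) (p : Conf n) :
    lineDeriv ℝ f (relabel σ p) (diagonal n) = lineDeriv ℝ f p (diagonal n) := by
  rw [lineDeriv, lineDeriv]
  congr 1
  funext t
  rw [← hs σ (p + t • diagonal n)]
  rfl

theorem continuous_lineDeriv (hf : ContDiff ℝ 1 f) (v : Conf n) :
    Continuous fun p => lineDeriv ℝ f p v := by
  have : (fun p => lineDeriv ℝ f p v) = fun p => fderiv ℝ f p v :=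
    funext fun p => (hf.differentiable one_ne_zero p).lineDeriv_eq_fderiv
  rw [this]
  exact (hf.continuous_fderiv one_ne_zero).clm_apply continuous_const

theorem hasCompactSupport_lineDeriv (hf : ContDiff ℝ 1 f) (hfc : HasCompactSupport f)
    (v : Conf n) : HasCompactSupport fun p => lineDeriv ℝ f p v := by
  have : (fun p => lineDeriv ℝ f p v) = fun p => fderiv ℝ f p v :=
    funext fun p => (hf.differentiable one_ne_zero p).lineDeriv_eq_fderiv
  rw [this]
  exact hfc.fderiv_apply (𝕜 := ℝ) v

/-- The witness is `(i/c)` times the diagonal derivative of `f`. It is only continuous, but that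
suffices because `T` is never applied twice. -/
theorem exists_timeOp_pureState {c : ℝ} (hc : c ≠ 0) (hf : ContDiff ℝ 1 f)
    (hfc : HasCompactSupport f) (hs : ∀ (σ : Equiv.Perm (Fin n)) p, f (relabel σ p) = f p) :
    ∃ (h : Conf n → ℂ) (_ : Continuous h) (_ : HasCompactSupport h) (hh : MemLp h 2 volume)
      (ht : ∀ (σ : Equiv.Perm (Fin n)) p, h (relabel σ p) = h p),
      ∀ hfm : MemLp f 2 volume,
      (pureState f hfm (relabel_ae_eq hs),
        pureState h hh (relabel_ae_eq ht)) ∈ (timeOp c).graph := by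
  have hcont : Continuous fun p => (Complex.I / c) * lineDeriv ℝ f p (diagonal n) :=
    (continuous_lineDeriv hf _).const_mul _
  have hcomp : HasCompactSupport fun p => (Complex.I / c) * lineDeriv ℝ f p (diagonal n) :=
    (hasCompactSupport_lineDeriv hf hfc _).mul_left
  refine ⟨_, hcont, hcomp, hcont.memLp_of_hasCompactSupport hcomp, fun σ p => by
    rw [lineDeriv_relabel hs], fun hfm => mem_graph_timeOp_pureState _ _ _ _ hc ?_⟩
  refine hasDerivAt_translate hf hfc _ hfm.coeFn_toLp ?_
  filter_upwards [(hcont.memLp_of_hasCompactSupport hcomp (p := 2) (μ := volume)).coeFn_toLp,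
    Lp.coeFn_smul (-Complex.I * c) (hcont.memLp_of_hasCompactSupport hcomp (p := 2)
      (μ := volume)).toLp] with p h1 h2
  rw [h2, Pi.smul_apply, h1, smul_eq_mul, ← mul_assoc]
  have h3 : -Complex.I * c * (Complex.I / c) = 1 := by
    have hc' := Complex.ofReal_ne_zero.2 hc
    field_simp
    rw [Complex.I_sq, neg_neg]
  rw [h3, one_mul]

theorem contDiff_total {ω : ℝ → ℝ} (hω : ContDiff ℝ 1 ω) (n : ℕ) :
    ContDiff ℝ 1 (total ω : Conf n → ℝ) :=
  ContDiff.sum fun j _ => hω.comp (by fun_prop)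

theorem continuous_total {g : ℝ → ℝ} (hg : Continuous g) (n : ℕ) :
    Continuous (total g : Conf n → ℝ) :=
  continuous_finsetSum _ fun j _ => hg.comp (by fun_prop)

/-- `Ωf` is again `C¹` with compact support, so `T` applies to it; `Tf` is continuous with compact
support, so multiplying it by `Ω` stays in `L²`. -/
theorem exists_commutator_pureState {c : ℝ} (hc : c ≠ 0) {ω : ℝ → ℝ} (hω : ContDiff ℝ 1 ω)
    (hf : ContDiff ℝ 1 f) (hfc : HasCompactSupport f)
    (hs : ∀ (σ : Equiv.Perm (Fin n)) p, f (relabel σ p) = f p) (hfm : MemLp f 2 volume) :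
    ∃ z, (pureState f hfm (relabel_ae_eq hs), z)
      ∈ (commutator (timeOp c) (clockHamiltonian ω)).graph := by
  have hΩ : Continuous fun p : Conf n => (total ω p : ℂ) :=
    Complex.continuous_ofReal.comp (continuous_total hω.continuous n)
  have hu1 : ContDiff ℝ 1 fun p => (total ω p : ℂ) * f p :=
    (Complex.ofRealCLM.contDiff.comp (contDiff_total hω n)).mul hf
  have huc : HasCompactSupport fun p => (total ω p : ℂ) * f p := hfc.mul_left
  have hus : ∀ (σ : Equiv.Perm (Fin n)) p,
      (fun p => (total ω p : ℂ) * f p) (relabel σ p) = (fun p => (total ω p : ℂ) * f p) p := by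
    intro σ p
    simp only [total_relabel, hs]
  have hum := hu1.continuous.memLp_of_hasCompactSupport huc (p := 2) (μ := volume)
  obtain ⟨y, -, -, hy, hys, hT1⟩ := exists_timeOp_pureState hc hu1 huc hus
  obtain ⟨v, hv, hvc, hvm, hvs, hT2⟩ := exists_timeOp_pureState hc hf hfc hs
  have hwc : HasCompactSupport fun p => (total ω p : ℂ) * v p := hvc.mul_left
  have hwm := (hΩ.mul hv).memLp_of_hasCompactSupport hwc (p := 2) (μ := volume)
  have hws : ∀ (σ : Equiv.Perm (Fin n)) p,
      (fun p => (total ω p : ℂ) * v p) (relabel σ p) = (fun p => (total ω p : ℂ) * v p) p := by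
    intro σ p
    simp only [total_relabel, hvs]
  exact ⟨_, (mem_graph_commutator _ _ _ _).2 ⟨_, _, _, _,
    mem_graph_momentumOp_pureState hfm _ hum
      (relabel_ae_eq (f := fun p => (total ω p : ℂ) * f p) hus) (ae_eq_refl _),
    hT1 hum, hT2 hfm,
    mem_graph_momentumOp_pureState hvm _ hwm
      (relabel_ae_eq (f := fun p => (total ω p : ℂ) * v p) hws) (ae_eq_refl _),
    rfl⟩⟩

end Core

/-! ### Density of compactly supported smooth amplitudes -/

theorem hasCompactSupport_sum {ι X : Type*} [TopologicalSpace X] (s : Finset ι) {f : ι → X → ℝ}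
    (h : ∀ i, HasCompactSupport (f i)) : HasCompactSupport fun x => ∑ i ∈ s, f i x := by
  classical
  induction s using Finset.induction_on with
  | empty =>
    simp only [Finset.sum_empty]
    exact HasCompactSupport.zero
  | insert i s hi ih =>
    simp only [Finset.sum_insert hi]
    exact (h i).add ih

/-- A symmetric amplitude that is orthogonal to `k φ` for all symmetric test functions `φ` vanishes,
if `k` is continuous, symmetric, and has no zeros. -/
theorem ae_eq_zero_of_orthogonal_symmetric {n : ℕ} {F : WaveFn n} (hF : F ∈ sector n)
    {k : Conf n → ℂ} (hk : Continuous k) (hk0 : ∀ p, k p ≠ 0)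
    (hks : ∀ (σ : Equiv.Perm (Fin n)) p, k (relabel σ p) = k p)
    (h : ∀ φ : Conf n → ℝ, ContDiff ℝ 1 φ → HasCompactSupport φ →
      (∀ (σ : Equiv.Perm (Fin n)) p, φ (relabel σ p) = φ p) →
      ∫ p, F p * (starRingEnd ℂ) (k p * φ p) = 0) : F = 0 := by
  let G : Conf n → ℂ := fun p => F p * (starRingEnd ℂ) (k p)
  have hG : LocallyIntegrable G volume :=
    ((Lp.memLp F).locallyIntegrable (by norm_num)).mul_continuous
      (Complex.continuous_conj.comp hk)
  have hGs : ∀ σ : Equiv.Perm (Fin n), (fun p => G (relabel σ p)) =ᵐ[volume] G := by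
    intro σ
    filter_upwards [hF σ] with p hp
    simp only [G, hp, hks]
  have hG0 : ∀ᵐ p, G p = 0 := by
    refine ae_eq_zero_of_integral_contDiff_smul_eq_zero hG fun φ hφ hφc => ?_
    have hrel : ∀ σ : Equiv.Perm (Fin n), ContDiff ℝ 1 fun p => φ (relabel σ p) := by
      intro σ
      rw [← coe_relabelIsometry]
      exact (hφ.of_le (by exact_mod_cast le_top)).comp (relabelIsometry σ).contDiff
    have hrelc : ∀ σ : Equiv.Perm (Fin n), HasCompactSupport fun p => φ (relabel σ p) := by
      intro σ
      rw [← coe_relabelIsometry]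
      exact hφc.comp_homeomorph (relabelIsometry σ).toHomeomorph
    have hint : ∀ σ : Equiv.Perm (Fin n), ∫ p, φ (relabel σ p) • G p = ∫ p, φ p • G p := by
      intro σ
      rw [← (measurePreserving_relabel σ).integral_comp (by
        rw [← coe_relabelIsometry]
        exact (relabelIsometry σ).toHomeomorph.measurableEmbedding) fun p => φ p • G p]
      refine integral_congr_ae ?_
      filter_upwards [hGs σ] with p hp
      rw [hp]
    -- An arbitrary test function is symmetrized. As `G` is symmetric, each permutation contributes
    -- the same integral, and the factor `n!` is nonzero.
    have hsum := h (fun p => ∑ σ : Equiv.Perm (Fin n), φ (relabel σ p))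
      (ContDiff.sum fun σ _ => hrel σ) (hasCompactSupport_sum _ hrelc) (fun σ p =>
        Fintype.sum_equiv (Equiv.mulLeft σ) _ _ fun τ => rfl)
    have hsum' : ∫ p, ∑ σ : Equiv.Perm (Fin n), φ (relabel σ p) • G p = 0 := by
      rw [← hsum]
      refine integral_congr_ae (Eventually.of_forall fun p => ?_)
      change _ = F p * (starRingEnd ℂ) (k p * ((∑ σ : Equiv.Perm (Fin n), φ (relabel σ p) : ℝ) : ℂ))
      rw [map_mul, Complex.conj_ofReal, ← mul_assoc, Complex.ofReal_sum, Finset.mul_sum]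
      exact Finset.sum_congr rfl fun σ _ => by rw [Complex.real_smul, mul_comm]
    rw [integral_finsetSum _ fun σ _ =>
      hG.integrable_smul_left_of_hasCompactSupport (hrel σ).continuous (hrelc σ)] at hsum'
    simp only [hint, Finset.sum_const, Finset.card_univ] at hsum'
    exact (smul_eq_zero.1 hsum').resolve_left Fintype.card_ne_zero
  refine Lp.ext ?_
  filter_upwards [hG0, Lp.coeFn_zero ℂ 2 (volume : Measure (Conf n))] with p hp h0
  rw [h0, Pi.zero_apply]
  exact (mul_eq_zero.1 hp).resolve_right ((map_ne_zero _).2 (hk0 p))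

/-- Used with `k = 1` for the density of the domain of the commutator, and with `k = Λ + i` for the
range condition on the closure. -/
theorem eq_zero_of_inner_pureState {k : ∀ n, Conf n → ℂ} (hk : ∀ n, Continuous (k n))
    (hk0 : ∀ n p, k n p ≠ 0)
    (hks : ∀ n (σ : Equiv.Perm (Fin n)) p, k n (relabel σ p) = k n p) {g : Fock}
    (h : ∀ n (f : Conf n → ℂ), ContDiff ℝ 1 f → HasCompactSupport f →
      (∀ (σ : Equiv.Perm (Fin n)) p, f (relabel σ p) = f p) →
      ∃ (hf : MemLp (fun p => k n p * f p) 2 volume) (hs : ∀ σ : Equiv.Perm (Fin n),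
        (fun p => k n (relabel σ p) * f (relabel σ p)) =ᵐ[volume] fun p => k n p * f p),
        (inner ℂ (pureState (fun p => k n p * f p) hf hs) g : ℂ) = 0) : g = 0 := by
  refine lp.ext (funext fun n => Subtype.ext ?_)
  refine ae_eq_zero_of_orthogonal_symmetric (g n).2 (hk n) (hk0 n) (hks n) fun φ h1 h2 h3 => ?_
  obtain ⟨hf, hs, h4⟩ := h n (fun p => (φ p : ℂ)) (Complex.ofRealCLM.contDiff.comp h1)
    (h2.comp_left Complex.ofReal_zero) fun σ p => by rw [h3]
  rwa [inner_pureState] at h4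

/-! ### The commutator of the time operator and the Hamiltonian -/

section TimeHamiltonian

variable {c : ℝ} {ω : ℝ → ℝ}

theorem memLp_of_continuous {n : ℕ} {f : Conf n → ℂ} (hf : Continuous f) (hfc : HasCompactSupport f) :
    MemLp f 2 volume := hf.memLp_of_hasCompactSupport hfc

theorem dense_domain_commutator_timeOp (hc : c ≠ 0) (hω : ContDiff ℝ 1 ω) :
    Dense ((commutator (timeOp c) (clockHamiltonian ω)).domain : Set Fock) := by
  refine dense_of_forall_inner_eq_zero fun g hg => ?_
  refine eq_zero_of_inner_pureState (k := fun n _ => 1) (fun n => continuous_const)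
    (fun n p => one_ne_zero) (fun n σ p => rfl) fun n f h1 h2 h3 => ?_
  simp only [one_mul]
  have hfm := memLp_of_continuous h1.continuous h2
  refine ⟨hfm, relabel_ae_eq h3, hg _ ?_⟩
  obtain ⟨z, hz⟩ := exists_commutator_pureState hc hω h1 h2 h3 hfm
  exact LinearPMap.mem_domain_of_mem_graph hz

theorem inner_lambdaOp_im (hc : c ≠ 0) (ω : ℝ → ℝ) {ψ η : Fock}
    (h : (ψ, η) ∈ (lambdaOp c ω).graph) :
    (inner ℂ η ψ : ℂ).im = 0 := by
  have hc' := Complex.ofReal_ne_zero.2 hc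
  rw [lambdaOp, mem_graph_smul (one_div_ne_zero hc'), one_div, inv_inv] at h
  have h1 := inner_momentumOp_im _ h
  rw [inner_smul_left, Complex.conj_ofReal, Complex.im_ofReal_mul] at h1
  exact (mul_eq_zero.1 h1).resolve_left hc

/-- The criterion `closure_eq_of_symmetric` is tested on compactly supported `C¹` amplitudes. Since
`Λ` is real, `Λ + i` has imaginary part 1 and never vanishes; it is continuous because `ω` is `C¹`.
-/
theorem closure_commutator_timeOp (hc : c ≠ 0) (hω : ContDiff ℝ 1 ω) :
    (commutator (timeOp c) (clockHamiltonian ω)).IsClosable ∧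
      (commutator (timeOp c) (clockHamiltonian ω)).closure = Complex.I • lambdaOp c ω := by
  have hc' := Complex.ofReal_ne_zero.2 hc
  have hle := commutator_timeOp_le hc (hω.differentiable one_ne_zero)
  refine closure_eq_of_symmetric hle ?_ (fun x y h => inner_lambdaOp_im hc ω h) fun g hg => ?_
  · rw [lambdaOp, smul_smul]
    exact isClosed_smul_momentumOp (mul_ne_zero Complex.I_ne_zero (one_div_ne_zero hc')) _
  let Λ : ∀ n, Conf n → ℂ := fun n p => (1 / c : ℂ) * (total (deriv ω) p : ℂ)
  have hΛ : ∀ n, Continuous (Λ n) := fun n => continuous_const.mul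
    (Complex.continuous_ofReal.comp (continuous_total (hω.continuous_deriv le_rfl) n))
  have hΛs : ∀ n (σ : Equiv.Perm (Fin n)) p, Λ n (relabel σ p) = Λ n p := by
    intro n σ p
    simp only [Λ, total_relabel]
  refine eq_zero_of_inner_pureState (k := fun n p => Λ n p + Complex.I)
    (fun n => (hΛ n).add continuous_const) (fun n p h0 => ?_)
    (fun n σ p => by rw [hΛs]) fun n f h1 h2 h3 => ?_
  · have h4 := congrArg Complex.im h0
    have h5 : Λ n p = ((1 / c * total (deriv ω) p : ℝ) : ℂ) := by
      simp only [Λ]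
      push_cast
      rfl
    rw [h5, Complex.add_im, Complex.ofReal_im, Complex.I_im, Complex.zero_im, zero_add] at h4
    exact one_ne_zero h4
  · have hfm := memLp_of_continuous h1.continuous h2
    have hkc : HasCompactSupport fun p => (Λ n p + Complex.I) * f p := h2.mul_left
    have hkm := memLp_of_continuous (((hΛ n).add continuous_const).mul h1.continuous) hkc
    have hks : ∀ (σ : Equiv.Perm (Fin n)) p,
        (fun p => (Λ n p + Complex.I) * f p) (relabel σ p) = (Λ n p + Complex.I) * f p := by
      intro σ p
      simp only [hΛs, h3]
    refine ⟨hkm, relabel_ae_eq (f := fun p => (Λ n p + Complex.I) * f p) hks, ?_⟩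
    obtain ⟨z, hz⟩ := exists_commutator_pureState hc hω h1 h2 h3 hfm
    have hzΛ := (mem_graph_smul Complex.I_ne_zero _ _).1 (LinearPMap.le_graph_of_le hle hz)
    have key := hg _ (Complex.I⁻¹ • z) (by rwa [smul_inv_smul₀ Complex.I_ne_zero])
    have hlm := memLp_of_continuous ((hΛ n).mul h1.continuous) (h2.mul_left (f := Λ n))
    have hls : ∀ (σ : Equiv.Perm (Fin n)) p,
        (fun p => Λ n p * f p) (relabel σ p) = Λ n p * f p := by
      intro σ p
      simp only [hΛs, h3]
    have hl := mem_graph_lambdaOp_pureState hfm (relabel_ae_eq h3) hlm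
      (relabel_ae_eq (f := fun p => Λ n p * f p) hls) hc (ω := ω) (ae_eq_refl _)
    -- The value of the commutator is known only through the inclusion in `iΛ`; single-valuedness of
    -- `Λ` identifies it with the explicit product.
    rw [LinearPMap.mem_graph_snd_inj _ hzΛ hl rfl] at key
    rw [← key]
    congr 1
    refine lp.ext (funext fun m => Subtype.ext ?_)
    change _ = ((pureState _ hlm _ m : WaveFn m) + Complex.I • (pureState f hfm _ m : WaveFn m))
    by_cases hm : m = n
    · subst hm
      rw [pureState_self, pureState_self, pureState_self, ← MemLp.toLp_const_smul,
        ← MemLp.toLp_add]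
      congr 1
      funext p
      simp only [Pi.add_apply, Pi.mul_apply, Pi.smul_apply, smul_eq_mul, add_mul]
    · rw [pureState_ne _ _ hm, pureState_ne _ _ hm, pureState_ne _ _ hm, smul_zero, add_zero]

end TimeHamiltonian

/-! ### The commutator of `Λ` and the Hamiltonian -/

theorem memLp_mul_indicator {α : Type*} [MeasurableSpace α] {μ : Measure α} {S : Set α}
    (hS : MeasurableSet S) {X : α → ℂ} (hX : Measurable X) {M : ℝ} (hM : ∀ p ∈ S, ‖X p‖ ≤ M)
    (F : Lp ℂ 2 μ) : MemLp (fun p => X p * S.indicator F p) 2 μ := by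
  have h0 : MemLp (S.indicator F) 2 μ := (Lp.memLp F).indicator hS
  refine h0.of_le_mul (c := M) ?_ (Eventually.of_forall fun p => ?_)
  · have h1 : AEStronglyMeasurable X μ := hX.aestronglyMeasurable
    have h2 : AEStronglyMeasurable (S.indicator F) μ := (Lp.aestronglyMeasurable F).indicator hS
    exact h1.mul h2
  · rw [norm_mul]
    by_cases hp : p ∈ S
    · gcongr
      exact hM p hp
    · rw [Set.indicator_of_notMem hp, norm_zero, mul_zero, mul_zero]

/-- Smooth amplitudes may fail to lie in `D(Λ)`, as `deriv ω` is merely measurable. Instead, each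
component of `g` is truncated to the symmetric set where `|Ω|` and `|Λ|` are at most `R`. The
truncation lies in the domain, so `g` is orthogonal to it and vanishes on that set; these sets
exhaust the configurations. -/
theorem dense_domain_commutator_lambdaOp {c : ℝ} (hc : c ≠ 0) {ω : ℝ → ℝ} (hω : Measurable ω) :
    Dense ((commutator (lambdaOp c ω) (clockHamiltonian ω)).domain : Set Fock) := by
  refine dense_of_forall_inner_eq_zero fun g hg => ?_
  refine lp.ext (funext fun n => Subtype.ext ?_)
  let Ω : Conf n → ℂ := fun p => (total ω p : ℂ)
  let Λ : Conf n → ℂ := fun p => (1 / c : ℂ) * (total (deriv ω) p : ℂ)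
  have hΩ : Measurable Ω := Complex.measurable_ofReal.comp (measurable_total hω n)
  have hΛ : Measurable Λ := measurable_const.mul
    (Complex.measurable_ofReal.comp (measurable_total (measurable_deriv ω) n))
  have hΩs : ∀ (σ : Equiv.Perm (Fin n)) p, Ω (relabel σ p) = Ω p := by
    intro σ p
    simp only [Ω, total_relabel]
  have hΛs : ∀ (σ : Equiv.Perm (Fin n)) p, Λ (relabel σ p) = Λ p := by
    intro σ p
    simp only [Λ, total_relabel]
  have hvanish : ∀ R : ℕ, ∀ᵐ p, ‖Ω p‖ ≤ R → ‖Λ p‖ ≤ R → (g n : WaveFn n) p = 0 := by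
    intro R
    let S : Set (Conf n) := {p | ‖Ω p‖ ≤ R ∧ ‖Λ p‖ ≤ R}
    have hS : MeasurableSet S :=
      (measurableSet_le hΩ.norm measurable_const).inter (measurableSet_le hΛ.norm measurable_const)
    let f : Conf n → ℂ := S.indicator (g n : WaveFn n)
    have hsym : ∀ X : Conf n → ℂ, (∀ (σ : Equiv.Perm (Fin n)) p, X (relabel σ p) = X p) →
        ∀ σ : Equiv.Perm (Fin n),
        (fun p => X (relabel σ p) * f (relabel σ p)) =ᵐ[volume] fun p => X p * f p := by
      intro X hX σ
      filter_upwards [(g n).2 σ] with p hp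
      have hmem : relabel σ p ∈ S ↔ p ∈ S := by
        simp only [S, Set.mem_ofPred_eq, hΩs, hΛs]
      simp only [f, Set.indicator_apply, hmem, hX, hp]
    have hf : MemLp f 2 volume := (Lp.memLp (g n : WaveFn n)).indicator hS
    have hfs : ∀ σ : Equiv.Perm (Fin n), (fun p => f (relabel σ p)) =ᵐ[volume] f := by
      intro σ
      simpa only [one_mul] using hsym (fun _ => 1) (fun _ _ => rfl) σ
    have m1 := memLp_mul_indicator hS hΩ (fun p hp => hp.1) (g n : WaveFn n)
    have m2 := memLp_mul_indicator hS hΛ (fun p hp => hp.2) (g n : WaveFn n)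
    have m3 := memLp_mul_indicator hS (hΛ.mul hΩ) (M := (R : ℝ) * R) (fun p hp => by
      rw [Pi.mul_apply, norm_mul]
      exact mul_le_mul hp.2 hp.1 (norm_nonneg _) (Nat.cast_nonneg R)) (g n : WaveFn n)
    have hz := (mem_graph_commutator _ _ _ _).2 ⟨_, _, _, _,
      mem_graph_momentumOp_pureState (g := ω) hf hfs m1 (hsym Ω hΩs) (ae_eq_refl _),
      mem_graph_lambdaOp_pureState (ω := ω) m1 (hsym Ω hΩs) m3
        (hsym (Λ * Ω) fun σ p => by rw [Pi.mul_apply, Pi.mul_apply, hΩs, hΛs]) hc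
        (Eventually.of_forall fun p => mul_assoc _ _ _),
      mem_graph_lambdaOp_pureState (ω := ω) hf hfs m2 (hsym Λ hΛs) hc (ae_eq_refl _),
      mem_graph_momentumOp_pureState (g := ω) m2 (hsym Λ hΛs) m3
        (hsym (Λ * Ω) fun σ p => by rw [Pi.mul_apply, Pi.mul_apply, hΩs, hΛs])
        (Eventually.of_forall fun p => by
          simp only [Pi.mul_apply, Λ, Ω]
          ring), rfl⟩
    have h0 := hg _ (LinearPMap.mem_domain_of_mem_graph hz)
    rw [inner_pureState] at h0
    have h1 : ∫ p, ((‖f p‖ ^ 2 : ℝ) : ℂ) = 0 := by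
      rw [← h0]
      refine integral_congr_ae (Eventually.of_forall fun p => ?_)
      by_cases hp : p ∈ S
      · simp only [f, Set.indicator_of_mem hp, Complex.mul_conj']
        push_cast
        rfl
      · simp only [f, Set.indicator_of_notMem hp]
        simp
    rw [integral_complex_ofReal, Complex.ofReal_eq_zero,
      integral_eq_zero_iff_of_nonneg (fun p => sq_nonneg ‖f p‖)
        ((memLp_two_iff_integrable_sq_norm hf.1).1 hf)] at h1
    filter_upwards [h1] with p hp h2 h3
    have hpS : p ∈ S := ⟨h2, h3⟩
    have h4 : f p = 0 := by simpa using hp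
    rwa [show f p = (g n : WaveFn n) p from Set.indicator_of_mem hpS _] at h4
  refine Lp.ext ?_
  filter_upwards [ae_all_iff.2 hvanish, Lp.coeFn_zero ℂ 2 (volume : Measure (Conf n))] with p hp h0
  obtain ⟨R, hR⟩ := exists_nat_ge (max ‖Ω p‖ ‖Λ p‖)
  rw [hp R ((le_max_left _ _).trans hR) ((le_max_right _ _).trans hR)]
  exact h0.symm

theorem commutator_lambdaOp_le {c : ℝ} (hc : c ≠ 0) (ω : ℝ → ℝ) :
    commutator (lambdaOp c ω) (clockHamiltonian ω) ≤ 0 := by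
  refine le_of_graph fun ψ z h => ?_
  obtain ⟨u, v, y₁, y₂, h1, h2, h3, h4, rfl⟩ := (mem_graph_commutator _ _ _ _).1 h
  have heq : y₁ = y₂ := by
    refine lp.ext (funext fun n => Subtype.ext (Lp.ext ?_))
    filter_upwards [(mem_graph_momentumOp _ _ _).1 h1 n, (mem_graph_lambdaOp hc _ _ _).1 h2 n,
      (mem_graph_lambdaOp hc _ _ _).1 h3 n, (mem_graph_momentumOp _ _ _).1 h4 n] with p k1 k2 k3 k4
    rw [k2, k1, k4, k3, mul_left_comm]
  rw [heq, sub_self]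
  -- The operator `0` is everywhere defined, so lying below it means exactly vanishing on one's own
  -- domain.
  exact (LinearPMap.mem_graph_iff _).2 ⟨⟨ψ, trivial⟩, rfl, rfl⟩

/-! ### The number operator -/

theorem mem_graph_numberOp (ψ η : Fock) :
    (ψ, η) ∈ numberOp.graph ↔ ∀ n : ℕ, η n = (n : ℂ) • ψ n := by
  rw [numberOp, mem_graph_momentumOp]
  refine forall_congr' fun n => ?_
  rw [Subtype.ext_iff, Submodule.coe_smul, Lp.ext_iff]
  have h := Lp.coeFn_smul (n : ℂ) (ψ n : WaveFn n)
  have h' : (fun p => (total (fun _ => 1) p : ℂ) * (ψ n : WaveFn n) p)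
      = (n : ℂ) • ((ψ n : WaveFn n) : Conf n → ℂ) := by
    funext p
    simp [total]
  rw [h']
  exact ⟨fun h1 => h1.trans h.symm, fun h1 => h1.trans h⟩

/-- Here `ω' = c`, so in every sector the multipliers `(1/c) · nc` and `n` coincide and the maximal
domains agree with them. -/
theorem lambdaOp_linear {c : ℝ} (hc : c ≠ 0) : lambdaOp c (fun k => c * k) = numberOp := by
  refine eq_of_graph fun ψ η => ?_
  rw [mem_graph_lambdaOp hc, numberOp, mem_graph_momentumOp]
  have hd : deriv (fun k : ℝ => c * k) = fun _ => c := by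
    funext k
    simp
  refine forall_congr' fun n => ?_
  have h : ∀ p : Conf n, (1 / c : ℂ) * (total (deriv fun k : ℝ => c * k) p : ℂ)
      = (total (fun _ => 1) p : ℂ) := by
    intro p
    have hc' := Complex.ofReal_ne_zero.2 hc
    rw [hd]
    simp only [total, Finset.sum_const, Finset.card_univ, Fintype.card_fin, nsmul_eq_mul]
    push_cast
    field_simp
  simp only [h]

end BosonicClock

theorem theorem1 (c : ℝ) (hc : 0 < c) :
    -- for differentiable dispersion relations, on the natural domain of the commutator
    (∀ ω : ℝ → ℝ, Differentiable ℝ ω →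
      BosonicClock.commutator (BosonicClock.timeOp c) (BosonicClock.clockHamiltonian ω)
        ≤ Complex.I • BosonicClock.lambdaOp c ω) ∧
    -- for continuously differentiable ones, as an identity of closed, densely defined operators
    (∀ ω : ℝ → ℝ, ContDiff ℝ 1 ω →
      Dense ((BosonicClock.commutator (BosonicClock.timeOp c)
        (BosonicClock.clockHamiltonian ω)).domain : Set BosonicClock.Fock) ∧
      (BosonicClock.commutator (BosonicClock.timeOp c)
        (BosonicClock.clockHamiltonian ω)).IsClosable ∧
      (BosonicClock.commutator (BosonicClock.timeOp c)
        (BosonicClock.clockHamiltonian ω)).closure = Complex.I • BosonicClock.lambdaOp c ω) ∧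
    -- `Λ` commutes with `H_C`, and is a constant of motion
    (∀ ω : ℝ → ℝ, Differentiable ℝ ω →
      Dense ((BosonicClock.commutator (BosonicClock.lambdaOp c ω)
        (BosonicClock.clockHamiltonian ω)).domain : Set BosonicClock.Fock) ∧
      BosonicClock.commutator (BosonicClock.lambdaOp c ω) (BosonicClock.clockHamiltonian ω) ≤ 0 ∧
      ∃ V : ℝ → BosonicClock.Fock ≃ₗᵢ[ℂ] BosonicClock.Fock,
        BosonicClock.IsEvolution (BosonicClock.clockHamiltonian ω) V ∧
        ∀ t : ℝ, BosonicClock.opMul (BosonicClock.ofUnitary (V (-t)))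
          (BosonicClock.opMul (BosonicClock.lambdaOp c ω) (BosonicClock.ofUnitary (V t)))
            = BosonicClock.lambdaOp c ω) ∧
    -- the linear dispersion relation, and the number operator
    (BosonicClock.lambdaOp c (fun k => c * k) = BosonicClock.numberOp ∧
      (BosonicClock.commutator (BosonicClock.timeOp c)
        (BosonicClock.clockHamiltonian (fun k => c * k))).closure
          = Complex.I • BosonicClock.numberOp ∧
      ∀ ψ η : BosonicClock.Fock, (ψ, η) ∈ BosonicClock.numberOp.graph ↔
        ∀ n : ℕ, η n = (n : ℂ) • ψ n) := by
  have hc0 : c ≠ 0 := hc.ne'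
  have hlin : ContDiff ℝ 1 fun k : ℝ => c * k := contDiff_const.mul contDiff_id
  refine ⟨fun ω hω => BosonicClock.commutator_timeOp_le hc0 hω, fun ω hω => ?_, fun ω hω => ?_,
    BosonicClock.lambdaOp_linear hc0, ?_, BosonicClock.mem_graph_numberOp⟩
  · exact ⟨BosonicClock.dense_domain_commutator_timeOp hc0 hω,
      BosonicClock.closure_commutator_timeOp hc0 hω⟩
  · have hm : Measurable ω := hω.continuous.measurable
    exact ⟨BosonicClock.dense_domain_commutator_lambdaOp hc0 hm,
      BosonicClock.commutator_lambdaOp_le hc0 ω, BosonicClock.evolution hm,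
      BosonicClock.isEvolution_evolution hm, fun t =>
        BosonicClock.evolution_conj_momentumOp hm
          (one_div_ne_zero (Complex.ofReal_ne_zero.2 hc0)) _ t⟩
  · rw [(BosonicClock.closure_commutator_timeOp hc0 hlin).2, BosonicClock.lambdaOp_linear hc0]
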